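/- Let $S$ be a smooth 3-manifold (Hausdorff, second countable, without boundary), $J\subseteq\mathbb R$ an open interval, and consider the spacetime $J\times S$ with time $t=x^0\in J$ and coordinates $x^1,x^2,x^3$ given by charts of $S$. Let $\varepsilon,\sigma\in\{1,-1\}$, $\eta=\sigma\,\mathrm{diag}(1,-1,-1,-1)$, and let $\gamma^A$ ($A=0,\dots,3$) be constant complex $4\times4$ matrices with $\{\gamma^A,\gamma^B\}=2\varepsilon\eta^{AB}I$ and $(\gamma^A)^\dagger=\gamma^0\gamma^A\gamma^0$. Let $e_A$ be a $C^1$ tetrad on $J\times S$ (four everywhere linearly independent vector fields), $g_{\alpha\beta}=e^A{}_\alpha e^B{}_\beta\,\eta_{AB}$ the metric it determines, $\nabla$ its Levi-Civita connection, $g=\det(g_{\alpha\beta})$, and $$\bar\gamma^\mu=e_A{}^\mu\gamma^A,\quad \omega_{AB\mu}=g_{\beta\alpha}e_A{}^\alpha\nabla_\mu e_B{}^\beta,\quad \Gamma_\mu=\tfrac{\varepsilon}{4}\,\omega_{AB\mu}\gamma^A\gamma^B,\quad D_\mu\psi=\partial_\mu\psi+\Gamma_\mu\psi,\quad \bar\phi=\phi^\dagger\gamma^0,\quad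 D_\mu\bar\phi=\partial_\mu\bar\phi-\bar\phi\,\Gamma_\mu .$$ Let $m\in\mathbb R$ and let $\phi,\psi:J\times S\to\mathbb C^4$ be $C^1$. Suppose that $\psi$ satisfies the Dirac equation $i\bar\gamma^\mu D_\mu\psi-m\psi=0$, and that $\phi$ satisfies the Dirac equation or $\bar\phi$ satisfies the adjoint equation $i(D_\mu\bar\phi)\bar\gamma^\mu+m\bar\phi=0$. (In the conventions with $(\gamma^0)^2=-I$, that is $\varepsilon\sigma=-1$, the factor $i$ is absorbed in the $\gamma^A$ and is to be omitted from both equations.) Suppose further that one of the following holds. (a) (Closed universe) $S$ is compact. (b) (Vanishing sufficiently rapidly at spatial infinity) For each $t\in J$ the function $\bar\phi\,\bar\gamma^0\psi$ is integrable over $\{t\}\times S$ with respect to $\sqrt{-g}\,d^3x$, and there is a $C^1$ function $\rho:S\to\mathbb R$ with compact sublevel sets such that for each $[a,b]\subset J$ $$\lim_{R\to\infty}\frac1R\int_a^b\int_{\{R\le\rho\le 2R\}}\Big|\sum_{k=1}^{3}\bar\phi\,\bar\gamma^k\psi\;\partial_k\rho\Big|\,\sqrt{-g}\,d^3x\,dt=0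 .$$ Then for every $t\in J$ the scalar product $$(\phi\,|\,\psi)=-\int_{\{t\}\times S}\bar\phi\,\bar\gamma^0\psi\,\sqrt{-g}\,d^3x$$ is well defined (the integrand is integrable), and it is conserved: $\dfrac{d}{dt}(\phi\,|\,\psi)=0$ on $J$, so that $(\phi\,|\,\psi)$ does not depend on $t$. -/

import Mathlib

open Set Filter Topology MeasureTheory Matrix
open scoped Manifold ContDiff

noncomputable section

namespace CurvedDirac

/-! ### Spinors and gamma matrices -/

/-- Four-component spinors. -/
abbrev Spinor : Type := Fin 4 → ℂ

/-- The Minkowski metric `η` of signature `(+,-,-,-)` for `σ = 1` and `(-,+,+,+)` for `σ = -1`.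
It is its own inverse, so it serves both as `η_{AB}` and as `η^{AB}`. -/
def minkowski (σ : ℝ) : Matrix (Fin 4) (Fin 4) ℝ :=
  σ • Matrix.diagonal ![1, -1, -1, -1]

/-- A representation of the (constant) gamma matrices: `{γ^A, γ^B} = 2 ε η^{AB} I` with `ε = ±1`,
for either metric signature, and the hermiticity conditions `(γ^A)† = γ^0 γ^A γ^0`. -/
structure IsGammaRep (ε σ : ℝ) (γ : Fin 4 → Matrix (Fin 4) (Fin 4) ℂ) : Prop where
  sign_eq : ε = 1 ∨ ε = -1
  signature_eq : σ = 1 ∨ σ = -1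
  anticomm : ∀ A B, γ A * γ B + γ B * γ A = ((2 * ε * minkowski σ A B : ℝ) : ℂ) • 1
  herm : ∀ A, (γ A)ᴴ = γ 0 * γ A * γ 0

/-- The factor of the kinetic term of the Dirac equation. One has `(γ^0)² = (ε σ) I`; the equation
is `i γ D ψ - m ψ = 0` when `(γ^0)² = I`, and `γ D ψ - m ψ = 0` when `(γ^0)² = -I`, where the
factor `i` is absorbed in the gamma matrices. -/
def diracFactor (ε σ : ℝ) : ℂ := if ε * σ = 1 then Complex.I else 1

/-- The Dirac adjoint `φ̄ = φ† γ^0`, a row spinor. -/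
def diracAdjoint (γ : Fin 4 → Matrix (Fin 4) (Fin 4) ℂ) (φ : Spinor) : Spinor :=
  star φ ᵥ* γ 0

/-! ### Tetrads and spinors in coordinates `x = (x^0, x^1, x^2, x^3)`

A tetrad is given by its components: `e x A μ` is the component `e_A^μ` at `x`. -/

section Coordinates

/-- The partial derivative `∂_μ f`. -/
def pd {F : Type*} [NormedAddCommGroup F] [NormedSpace ℝ F]
    (μ : Fin 4) (f : (Fin 4 → ℝ) → F) (x : Fin 4 → ℝ) : F :=
  fderiv ℝ f x (Pi.single μ 1)

/-- The dual tetrad: `coframe e x α A` is the component `e^A_α`, so that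
`e^A_α e_B^α = δ^A_B`. -/
def coframe (e : (Fin 4 → ℝ) → Matrix (Fin 4) (Fin 4) ℝ) (x : Fin 4 → ℝ) :
    Matrix (Fin 4) (Fin 4) ℝ :=
  (e x)⁻¹

/-- The metric `g_{αβ} = e^A_α e^B_β η_{AB}`, for which the tetrad is orthonormal. -/
def metric (σ : ℝ) (e : (Fin 4 → ℝ) → Matrix (Fin 4) (Fin 4) ℝ) (x : Fin 4 → ℝ) :
    Matrix (Fin 4) (Fin 4) ℝ :=
  Matrix.of fun α β => ∑ A, ∑ B, coframe e x α A * coframe e x β B * minkowski σ A B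

/-- The volume factor `√(-g)`, with `g = det (g_{αβ})`. -/
def sqrtNegDet (σ : ℝ) (e : (Fin 4 → ℝ) → Matrix (Fin 4) (Fin 4) ℝ) (x : Fin 4 → ℝ) : ℝ :=
  Real.sqrt (-(metric σ e x).det)

/-- The Christoffel symbols `Γ^l_{μν}` of the metric. -/
def christoffel (σ : ℝ) (e : (Fin 4 → ℝ) → Matrix (Fin 4) (Fin 4) ℝ)
    (l μ ν : Fin 4) (x : Fin 4 → ℝ) : ℝ :=
  (1 / 2 : ℝ) * ∑ κ, (metric σ e x)⁻¹ l κ *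
    (pd μ (fun z => metric σ e z ν κ) x + pd ν (fun z => metric σ e z μ κ) x
      - pd κ (fun z => metric σ e z μ ν) x)

/-- The components `∇_μ e_B^β` of the covariant derivative of the tetrad vector `e_B`. -/
def covDerivFrame (σ : ℝ) (e : (Fin 4 → ℝ) → Matrix (Fin 4) (Fin 4) ℝ)
    (μ B β : Fin 4) (x : Fin 4 → ℝ) : ℝ :=
  pd μ (fun z => e z B β) x + ∑ ν, christoffel σ e β μ ν x * e x B ν

/-- The spin connection coefficients `ω_{ABμ} = g_{βα} e_A^α ∇_μ e_B^β`. -/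
def spinConnection (σ : ℝ) (e : (Fin 4 → ℝ) → Matrix (Fin 4) (Fin 4) ℝ)
    (A B μ : Fin 4) (x : Fin 4 → ℝ) : ℝ :=
  ∑ α, ∑ β, metric σ e x β α * e x A α * covDerivFrame σ e μ B β x

/-- The spinor affine connection `Γ_μ = (ε/4) ω_{ABμ} γ^A γ^B`. -/
def spinorConnection (ε σ : ℝ) (γ : Fin 4 → Matrix (Fin 4) (Fin 4) ℂ)
    (e : (Fin 4 → ℝ) → Matrix (Fin 4) (Fin 4) ℝ) (μ : Fin 4) (x : Fin 4 → ℝ) :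
    Matrix (Fin 4) (Fin 4) ℂ :=
  ∑ A, ∑ B, ((ε / 4 * spinConnection σ e A B μ x : ℝ) : ℂ) • (γ A * γ B)

/-- The spacetime dependent gamma matrices `γ̄^μ = e_A^μ γ^A`. -/
def gammaBar (γ : Fin 4 → Matrix (Fin 4) (Fin 4) ℂ)
    (e : (Fin 4 → ℝ) → Matrix (Fin 4) (Fin 4) ℝ) (μ : Fin 4) (x : Fin 4 → ℝ) :
    Matrix (Fin 4) (Fin 4) ℂ :=
  ∑ A, ((e x A μ : ℝ) : ℂ) • γ A

/-- The spinor covariant derivative `D_μ ψ = ∂_μ ψ + Γ_μ ψ`. -/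
def spinorD (ε σ : ℝ) (γ : Fin 4 → Matrix (Fin 4) (Fin 4) ℂ)
    (e : (Fin 4 → ℝ) → Matrix (Fin 4) (Fin 4) ℝ) (ψ : (Fin 4 → ℝ) → Spinor)
    (μ : Fin 4) (x : Fin 4 → ℝ) : Spinor :=
  pd μ ψ x + spinorConnection ε σ γ e μ x *ᵥ ψ x

/-- The covariant derivative of the adjoint spinor, `D_μ φ̄ = ∂_μ φ̄ - φ̄ Γ_μ`. -/
def adjointD (ε σ : ℝ) (γ : Fin 4 → Matrix (Fin 4) (Fin 4) ℂ)
    (e : (Fin 4 → ℝ) → Matrix (Fin 4) (Fin 4) ℝ) (φ : (Fin 4 → ℝ) → Spinor)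
    (μ : Fin 4) (x : Fin 4 → ℝ) : Spinor :=
  pd μ (fun z => diracAdjoint γ (φ z)) x
    - diracAdjoint γ (φ x) ᵥ* spinorConnection ε σ γ e μ x

/-- The Dirac equation `i γ̄^μ D_μ ψ - m ψ = 0` at the point with coordinates `x`
(see `diracFactor` for the factor `i`). -/
def DiracEqAt (ε σ : ℝ) (γ : Fin 4 → Matrix (Fin 4) (Fin 4) ℂ) (m : ℝ)
    (e : (Fin 4 → ℝ) → Matrix (Fin 4) (Fin 4) ℝ) (ψ : (Fin 4 → ℝ) → Spinor)
    (x : Fin 4 → ℝ) : Prop :=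
  diracFactor ε σ • (∑ μ, gammaBar γ e μ x *ᵥ spinorD ε σ γ e ψ μ x) - (m : ℂ) • ψ x = 0

/-- The adjoint Dirac equation `i (D_μ φ̄) γ̄^μ + m φ̄ = 0` at the point with coordinates `x`. -/
def AdjointDiracEqAt (ε σ : ℝ) (γ : Fin 4 → Matrix (Fin 4) (Fin 4) ℂ) (m : ℝ)
    (e : (Fin 4 → ℝ) → Matrix (Fin 4) (Fin 4) ℝ) (φ : (Fin 4 → ℝ) → Spinor)
    (x : Fin 4 → ℝ) : Prop :=
  diracFactor ε σ • (∑ μ, adjointD ε σ γ e φ μ x ᵥ* gammaBar γ e μ x)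
    + (m : ℂ) • diracAdjoint γ (φ x) = 0

end Coordinates

/-! ### The spacetime `J × S`

The slices of constant time `t = x^0 ∈ J` are copies of a three-dimensional manifold `S`. Fields are
functions on `ℝ × S` of which only the values over `J` matter. -/

section Spacetime

/-- The model space of the slices. -/
abbrev E3 : Type := EuclideanSpace ℝ (Fin 3)

/-- The model with corners of the four-dimensional manifold `ℝ × S`. -/
abbrev I4 : ModelWithCorners ℝ (ℝ × E3) (ModelProd ℝ E3) := 𝓘(ℝ, ℝ).prod (𝓡 3)

variable {S : Type*} [TopologicalSpace S] [ChartedSpace E3 S]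

/-- A tetrad on `J × S`: four continuously differentiable vector fields that are linearly
independent at each point. -/
structure IsTetrad [IsManifold (𝓡 3) ∞ S] (J : Set ℝ)
    (e : Fin 4 → (q : ℝ × S) → TangentSpace I4 q) : Prop where
  contMDiffOn : ∀ A, ContMDiffOn I4 I4.tangent 1
    (fun q => (⟨q, e A q⟩ : TangentBundle I4 (ℝ × S))) (J ×ˢ univ)
  linearIndependent : ∀ q ∈ J ×ˢ (univ : Set S), LinearIndependent ℝ (fun A => e A q)

/-- The derivative `e_A(f)` of a function `f` on spacetime along the tetrad vector `e_A`. -/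
def frameDeriv (e : Fin 4 → (q : ℝ × S) → TangentSpace I4 q) (A : Fin 4)
    (f : ℝ × S → ℝ) (q : ℝ × S) : ℝ :=
  mfderiv I4 𝓘(ℝ, ℝ) f q (e A q)

/-- The coordinate functions `x^0 = t` and `x^1, x^2, x^3` given by a chart `c` of `S`. -/
def coord (c : OpenPartialHomeomorph S E3) (μ : Fin 4) (q : ℝ × S) : ℝ :=
  (Fin.cons q.1 (fun i => c q.2 i) : Fin 4 → ℝ) μ

/-- The point of spacetime with coordinates `x`. -/
def point (c : OpenPartialHomeomorph S E3) (x : Fin 4 → ℝ) : ℝ × S :=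
  (x 0, c.symm (WithLp.toLp 2 (Fin.tail x)))

/-- The coordinates that a chart `c` of `S` gives to the points of `J × S`. -/
def coordDomain (J : Set ℝ) (c : OpenPartialHomeomorph S E3) : Set (Fin 4 → ℝ) :=
  {x | x 0 ∈ J ∧ WithLp.toLp 2 (Fin.tail x) ∈ c.target}

/-- The components `e_A^μ = e_A(x^μ)` of the tetrad, as functions of the coordinates. -/
def frameInChart (e : Fin 4 → (q : ℝ × S) → TangentSpace I4 q)
    (c : OpenPartialHomeomorph S E3) (x : Fin 4 → ℝ) : Matrix (Fin 4) (Fin 4) ℝ :=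
  Matrix.of fun A μ => frameDeriv e A (coord c μ) (point c x)

/-- `ψ` solves the Dirac equation with mass `m` on `J × S`, in the coordinates of every chart. -/
def SolvesDirac (ε σ : ℝ) (γ : Fin 4 → Matrix (Fin 4) (Fin 4) ℂ) (m : ℝ) (J : Set ℝ)
    (e : Fin 4 → (q : ℝ × S) → TangentSpace I4 q) (ψ : ℝ × S → Spinor) : Prop :=
  ∀ c ∈ atlas E3 S, ∀ x ∈ coordDomain J c,
    DiracEqAt ε σ γ m (frameInChart e c) (fun z => ψ (point c z)) x

/-- `φ̄` solves the adjoint Dirac equation with mass `m` on `J × S`, in the coordinates of every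
chart. -/
def SolvesAdjointDirac (ε σ : ℝ) (γ : Fin 4 → Matrix (Fin 4) (Fin 4) ℂ) (m : ℝ) (J : Set ℝ)
    (e : Fin 4 → (q : ℝ × S) → TangentSpace I4 q) (φ : ℝ × S → Spinor) : Prop :=
  ∀ c ∈ atlas E3 S, ∀ x ∈ coordDomain J c,
    AdjointDiracEqAt ε σ γ m (frameInChart e c) (fun z => φ (point c z)) x

/-- The function `φ̄ γ̄(df) ψ = (e_A(f)) φ̄ γ^A ψ`. For `f = x^μ` it is `φ̄ γ̄^μ ψ`. -/
def currentAlong (γ : Fin 4 → Matrix (Fin 4) (Fin 4) ℂ)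
    (e : Fin 4 → (q : ℝ × S) → TangentSpace I4 q) (φ ψ : ℝ × S → Spinor)
    (f : ℝ × S → ℝ) (q : ℝ × S) : ℂ :=
  diracAdjoint γ (φ q) ⬝ᵥ ((∑ A, ((frameDeriv e A f q : ℝ) : ℂ) • γ A) *ᵥ ψ q)

variable [MeasurableSpace S]

/-- The measure `√(-g) d³x` on the slice of time `t`. On the domain of each chart of `S` it is the
image of the measure `√(-g) d³x` on the target of the chart; since these measures agree where
domains overlap, the least measure above all of them restricts to each of them. -/
def sliceMeasure (σ : ℝ) (e : Fin 4 → (q : ℝ × S) → TangentSpace I4 q) (t : ℝ) : Measure S :=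
  ⨆ c ∈ atlas E3 S, Measure.map c.symm
    ((volume.restrict c.target).withDensity fun y : E3 =>
      ENNReal.ofReal (sqrtNegDet σ (frameInChart e c) (Fin.cons t (fun i => y i) : Fin 4 → ℝ)))

/-- The scalar product `(φ|ψ) = -∫ φ̄ γ̄^0 ψ √(-g) d³x` over the slice of time `t`. -/
def scalarProduct (σ : ℝ) (γ : Fin 4 → Matrix (Fin 4) (Fin 4) ℂ)
    (e : Fin 4 → (q : ℝ × S) → TangentSpace I4 q) (φ ψ : ℝ × S → Spinor) (t : ℝ) : ℂ :=
  -∫ p, currentAlong γ e φ ψ Prod.fst (t, p) ∂(sliceMeasure σ e t)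

/-- `φ` and `ψ` vanish sufficiently rapidly at spatial infinity: the scalar product is well defined
on each slice, and for some radial function `ρ` on `S` (one whose sublevel sets are compact) the
quantity `|φ̄ γ̄^k ψ ∂_k ρ|`, integrated over the shell `R ≤ ρ ≤ 2R` and over any compact interval of
time, is `o(R)` as `R → ∞`. For `S = ℝ³` and `ρ = √(1 + |x|²)` the last condition holds whenever
`√(-g) φ̄ γ̄^k ψ` is `o(|x|⁻²)`, uniformly on compact intervals of time, or is integrable over
compact intervals of time and all of space. -/
structure VanishRapidly (σ : ℝ) (γ : Fin 4 → Matrix (Fin 4) (Fin 4) ℂ) (J : Set ℝ)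
    (e : Fin 4 → (q : ℝ × S) → TangentSpace I4 q) (φ ψ : ℝ × S → Spinor) : Prop where
  integrable : ∀ t ∈ J,
    Integrable (fun p => currentAlong γ e φ ψ Prod.fst (t, p)) (sliceMeasure σ e t)
  decay : ∃ ρ : S → ℝ, ContMDiff (𝓡 3) 𝓘(ℝ, ℝ) 1 ρ ∧ (∀ R : ℝ, IsCompact {p | ρ p ≤ R}) ∧
    ∀ a b : ℝ, Icc a b ⊆ J →
      Tendsto (fun R : ℝ => ENNReal.ofReal R⁻¹ * ∫⁻ t in Icc a b,
          ∫⁻ p in {p | R ≤ ρ p ∧ ρ p ≤ 2 * R},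
            ‖currentAlong γ e φ ψ (fun q => ρ q.2) (t, p)‖ₑ ∂(sliceMeasure σ e t))
        atTop (𝓝 0)

end Spacetime

end CurvedDirac

end

/-!
The integrand of `(φ|ψ)` is the time component of the current `j^μ = φ̄ γ̄^μ ψ`, and the proof
consists of the local conservation law `∂_μ (√(-g) j^μ) = 0` together with Gauss' theorem on the
slices.

**Local conservation** (`sum_pd_current`). Since `∇` is metric, the coefficients `ω_{ABμ}` are
antisymmetric in `A`, `B` (`spinConnection_antisymm`). The commutator of a bivector `γ^A γ^B` with
a gamma matrix is a vector, so that `Γ_μ` generates on the gamma matrices the rotation that the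
tetrad undergoes: `∇_μ γ̄^μ + [Γ_μ, γ̄^μ] = 0` (`sum_commutator_spinorConnection`). Moreover
`√(-g) = 1 / |det (e_A^μ)|`, and Jacobi's formula gives `∂_μ (√(-g) e_A^μ) = √(-g) ∇_μ e_A^μ`
(`sum_pd_sqrtNegDet_mul_frame`). By the product rule the divergence of the current is therefore
`√(-g) ((D_μ φ̄) γ̄^μ ψ + φ̄ γ̄^μ D_μ ψ)`, and the Dirac equation for `ψ` and the adjoint equation
for `φ̄` make the two terms cancel. If `φ` solves the Dirac equation, then `φ̄` solves the adjoint
equation, because `Γ_μ† γ^0 = - γ^0 Γ_μ` (`DiracEqAt.adjoint`).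

**Slices.** The measures `√(-g) d³x` of two charts agree on the overlap of the charts, by the change
of variables formula, so the supremum that defines `sliceMeasure` restricts to `√(-g) d³x` on every
chart (`IsTetrad.restrict_sliceMeasure`). For a weight `h` supported in a chart, integration of
`∂_μ (h √(-g) j^μ) = √(-g) j^μ ∂_μ h` over space gives the balance law
`d/dt ∫ h j^0 √(-g) d³x = ∫ j^k ∂_k h √(-g) d³x`. A partition of unity extends it to every `C¹`
weight of compact support (`DivergenceFree.hasBalance`).

**Conclusion.** On a compact `S` the weight `h = 1` is allowed and its flux is zero. Otherwise `h` is
a cutoff that is `1` for `ρ ≤ R` and `0` for `ρ ≥ 2 R`, with `|∂ h| ≤ (C / R) |∂ ρ|` supported in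
the shell between. The flux, integrated over a time interval, tends to zero as `R → ∞` by the decay
hypothesis, and the weighted charges tend to the total charges by dominated convergence
(`DivergenceFree.integral_eq_of_vanishRapidly`).
-/

namespace CurvedDirac

/-! ### Calculus of partial derivatives of matrix-valued functions -/

section PartialDerivatives

variable {x : Fin 4 → ℝ} {μ : Fin 4}

lemma pd_mul {𝔸 : Type*} [NormedCommRing 𝔸] [NormedAlgebra ℝ 𝔸] {f g : (Fin 4 → ℝ) → 𝔸}
    (hf : DifferentiableAt ℝ f x) (hg : DifferentiableAt ℝ g x) :
    pd μ (fun z => f z * g z) x = pd μ f x * g x + f x * pd μ g x := by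
  simp only [pd]
  rw [fderiv_fun_mul hf hg]
  simp only [_root_.add_apply, _root_.smul_apply, smul_eq_mul]
  ring

lemma pd_sum {ι F : Type*} [NormedAddCommGroup F] [NormedSpace ℝ F] {s : Finset ι}
    {f : ι → (Fin 4 → ℝ) → F} (hf : ∀ i ∈ s, DifferentiableAt ℝ (f i) x) :
    pd μ (fun z => ∑ i ∈ s, f i z) x = ∑ i ∈ s, pd μ (f i) x := by
  simp only [pd]
  rw [fderiv_fun_sum hf]
  simp

lemma pd_const {F : Type*} [NormedAddCommGroup F] [NormedSpace ℝ F] (c : F) :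
    pd μ (fun _ => c) x = 0 := by
  simp [pd]

lemma pd_congr {F : Type*} [NormedAddCommGroup F] [NormedSpace ℝ F] {f g : (Fin 4 → ℝ) → F}
    (h : f =ᶠ[𝓝 x] g) : pd μ f x = pd μ g x := by
  rw [pd, pd, h.fderiv_eq]

lemma pd_ofReal {f : (Fin 4 → ℝ) → ℝ} (hf : DifferentiableAt ℝ f x) :
    pd μ (fun z => (f z : ℂ)) x = ((pd μ f x : ℝ) : ℂ) := by
  have := (Complex.ofRealCLM.hasFDerivAt.comp x hf.hasFDerivAt).fderiv
  simp only [pd]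
  rw [show (fun z => (f z : ℂ)) = (Complex.ofRealCLM : ℝ → ℂ) ∘ f from rfl, this]
  rfl

lemma pd_apply {ι F : Type*} [Fintype ι] [NormedAddCommGroup F] [NormedSpace ℝ F]
    {f : (Fin 4 → ℝ) → ι → F} (hf : DifferentiableAt ℝ f x) (i : ι) :
    pd μ f x i = pd μ (fun z => f z i) x := by
  simp only [pd]
  rw [fderiv_apply hf i]
  rfl

/-- The matrix of the partial derivatives of the entries of a matrix-valued function. -/
noncomputable def pdMatrix {m n : Type*} (μ : Fin 4) (M : (Fin 4 → ℝ) → Matrix m n ℝ)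
    (x : Fin 4 → ℝ) : Matrix m n ℝ :=
  Matrix.of fun i j => pd μ (fun z => M z i j) x

/-- Differentiability of a matrix-valued function at a point, entry by entry: matrices carry no
canonical norm. -/
def DiffEntries {m n : Type*} (M : (Fin 4 → ℝ) → Matrix m n ℝ) (x : Fin 4 → ℝ) : Prop :=
  ∀ i j, DifferentiableAt ℝ (fun z => M z i j) x

variable {l m n : Type*}

lemma DiffEntries.mul [Fintype m] {M : (Fin 4 → ℝ) → Matrix l m ℝ} {N : (Fin 4 → ℝ) → Matrix m n ℝ}
    (hM : DiffEntries M x) (hN : DiffEntries N x) : DiffEntries (fun z => M z * N z) x := by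
  intro i j
  simp only [Matrix.mul_apply]
  exact DifferentiableAt.fun_sum fun k _ => (hM i k).mul (hN k j)

lemma pdMatrix_mul [Fintype m] {M : (Fin 4 → ℝ) → Matrix l m ℝ} {N : (Fin 4 → ℝ) → Matrix m n ℝ}
    (hM : DiffEntries M x) (hN : DiffEntries N x) :
    pdMatrix μ (fun z => M z * N z) x = pdMatrix μ M x * N x + M x * pdMatrix μ N x := by
  ext i j
  simp only [pdMatrix, Matrix.of_apply, Matrix.add_apply, Matrix.mul_apply]
  rw [pd_sum (f := fun k z => M z i k * N z k j) fun k _ => (hM i k).mul (hN k j),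
    ← Finset.sum_add_distrib]
  exact Finset.sum_congr rfl fun k _ => pd_mul (hM i k) (hN k j)

lemma DiffEntries.const (M : Matrix m n ℝ) : DiffEntries (fun _ => M) x :=
  fun _ _ => differentiableAt_const _

lemma pdMatrix_const (M : Matrix m n ℝ) : pdMatrix μ (fun _ => M) x = 0 := by
  ext i j
  simp [pdMatrix, pd_const]

lemma DiffEntries.transpose {M : (Fin 4 → ℝ) → Matrix m n ℝ} (hM : DiffEntries M x) :
    DiffEntries (fun z => (M z)ᵀ) x :=
  fun i j => hM j i

lemma pdMatrix_transpose (M : (Fin 4 → ℝ) → Matrix m n ℝ) :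
    pdMatrix μ (fun z => (M z)ᵀ) x = (pdMatrix μ M x)ᵀ := rfl

lemma DiffEntries.det [Fintype m] [DecidableEq m] {M : (Fin 4 → ℝ) → Matrix m m ℝ}
    (hM : DiffEntries M x) : DifferentiableAt ℝ (fun z => (M z).det) x := by
  simp only [Matrix.det_apply]
  refine DifferentiableAt.fun_sum fun s _ => DifferentiableAt.const_smul ?_ _
  exact (HasFDerivAt.finsetProd fun i _ => (hM (s i) i).hasFDerivAt).differentiableAt

lemma DiffEntries.inv [Fintype m] [DecidableEq m] {M : (Fin 4 → ℝ) → Matrix m m ℝ}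
    (hM : DiffEntries M x) (h : (M x).det ≠ 0) : DiffEntries (fun z => (M z)⁻¹) x := by
  intro i j
  simp only [Matrix.inv_def, Matrix.smul_apply, Ring.inverse_eq_inv', smul_eq_mul]
  refine (hM.det.inv h).mul ?_
  simp only [Matrix.adjugate_apply]
  refine DiffEntries.det fun a b => ?_
  simp only [Matrix.updateRow_apply]
  split_ifs
  · exact differentiableAt_const _
  · exact hM a b

/-- Jacobi's formula for the derivative of a determinant. -/
lemma pd_det [Fintype m] [DecidableEq m] {M : (Fin 4 → ℝ) → Matrix m m ℝ} (hM : DiffEntries M x) :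
    pd μ (fun z => (M z).det) x = ((M x).adjugate * pdMatrix μ M x).trace := by
  -- the derivative is the sum over the rows of the determinants with that row differentiated
  have key : ∀ v : Fin 4 → ℝ, fderiv ℝ (fun z => (M z).det) x v
      = ∑ i, ((M x).updateRow i fun j => fderiv ℝ (fun z => M z i j) x v).det := by
    intro v
    have h1 : HasFDerivAt (fun z => (M z).det) (∑ s : Equiv.Perm m, (Equiv.Perm.sign s : ℤ) •
        ∑ i, (∏ k ∈ Finset.univ.erase i, M x (s k) k) • fderiv ℝ (fun z => M z (s i) i) x) x := by
      simp only [Matrix.det_apply]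
      refine HasFDerivAt.fun_sum fun s _ => ?_
      exact (HasFDerivAt.finsetProd fun i _ => (hM (s i) i).hasFDerivAt).const_smul
        (Equiv.Perm.sign s : ℤ)
    rw [h1.fderiv]
    simp only [_root_.sum_apply, _root_.smul_apply, smul_eq_mul]
    simp only [Matrix.det_apply, Finset.smul_sum]
    rw [Finset.sum_comm (s := Finset.univ (α := m))]
    refine Finset.sum_congr rfl fun s _ => ?_
    rw [← Equiv.sum_comp s (fun i => (Equiv.Perm.sign s) • ∏ k, (M x).updateRow i
      (fun j => fderiv ℝ (fun z => M z i j) x v) (s k) k)]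
    refine Finset.sum_congr rfl fun i _ => ?_
    rw [Units.smul_def]
    congr 1
    rw [← Finset.mul_prod_erase Finset.univ _ (Finset.mem_univ i), mul_comm]
    congr 1
    · simp
    · refine Finset.prod_congr rfl fun k hk => ?_
      have : s k ≠ s i := fun h => (Finset.mem_erase.1 hk).1 (s.injective h)
      simp [Matrix.updateRow_ne this]
  rw [pd, key, Matrix.trace_mul_comm, Matrix.trace]
  refine Finset.sum_congr rfl fun i _ => ?_
  rw [Matrix.diag_apply, Matrix.mul_apply, ← Matrix.cramer_transpose_apply]
  rw [Matrix.cramer_eq_adjugate_mulVec, Matrix.mulVec, dotProduct]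
  refine Finset.sum_congr rfl fun k _ => ?_
  rw [← Matrix.adjugate_transpose, Matrix.transpose_apply, mul_comm]
  rfl

end PartialDerivatives

/-! ### The Levi-Civita connection of a tetrad -/

section LeviCivita

lemma minkowski_transpose (σ : ℝ) : (minkowski σ)ᵀ = minkowski σ := by
  simp [minkowski]

lemma minkowski_comm (σ : ℝ) (A B : Fin 4) : minkowski σ A B = minkowski σ B A := by
  conv_lhs => rw [← minkowski_transpose, Matrix.transpose_apply]

lemma minkowski_mul_self {σ : ℝ} (hσ : σ = 1 ∨ σ = -1) : minkowski σ * minkowski σ = 1 := by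
  have h : σ * σ = 1 := by rcases hσ with rfl | rfl <;> norm_num
  ext i j
  fin_cases i <;> fin_cases j <;> simp [minkowski, Matrix.mul_apply, Fin.sum_univ_four, h]

lemma det_minkowski {σ : ℝ} (hσ : σ = 1 ∨ σ = -1) : (minkowski σ).det = -1 := by
  rcases hσ with rfl | rfl <;> simp [minkowski, Fin.prod_univ_four]

variable {σ : ℝ} {e : (Fin 4 → ℝ) → Matrix (Fin 4) (Fin 4) ℝ} {x : Fin 4 → ℝ}

lemma metric_eq_mul (σ : ℝ) (e : (Fin 4 → ℝ) → Matrix (Fin 4) (Fin 4) ℝ) (x : Fin 4 → ℝ) :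
    metric σ e x = coframe e x * minkowski σ * (coframe e x)ᵀ := by
  ext α β
  simp only [metric, Matrix.of_apply, Matrix.mul_apply, Matrix.transpose_apply, Finset.sum_mul]
  rw [Finset.sum_comm]
  refine Finset.sum_congr rfl fun A _ => Finset.sum_congr rfl fun B _ => ?_
  ring

lemma metric_transpose (σ : ℝ) (e : (Fin 4 → ℝ) → Matrix (Fin 4) (Fin 4) ℝ) (x : Fin 4 → ℝ) :
    (metric σ e x)ᵀ = metric σ e x := by
  simp [metric_eq_mul, minkowski_transpose, Matrix.mul_assoc]

lemma frame_mul_coframe (h : (e x).det ≠ 0) : e x * coframe e x = 1 :=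
  Matrix.mul_nonsing_inv _ (isUnit_iff_ne_zero.2 h)

lemma coframe_mul_frame (h : (e x).det ≠ 0) : coframe e x * e x = 1 :=
  Matrix.nonsing_inv_mul _ (isUnit_iff_ne_zero.2 h)

/-- The volume factor is the reciprocal of the absolute value of the determinant of the tetrad
components, also where the latter vanishes. -/
lemma sqrtNegDet_eq (hσ : σ = 1 ∨ σ = -1) (e : (Fin 4 → ℝ) → Matrix (Fin 4) (Fin 4) ℝ)
    (x : Fin 4 → ℝ) : sqrtNegDet σ e x = |(e x).det|⁻¹ := by
  rw [sqrtNegDet, metric_eq_mul, Matrix.det_mul, Matrix.det_mul, Matrix.det_transpose,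
    det_minkowski hσ, coframe, Matrix.det_nonsing_inv, Ring.inverse_eq_inv']
  rw [show -((e x).det⁻¹ * -1 * (e x).det⁻¹) = (e x).det⁻¹ ^ 2 by ring, Real.sqrt_sq_eq_abs,
    abs_inv]

/-- The tetrad is orthonormal. -/
lemma frame_mul_metric (h : (e x).det ≠ 0) :
    e x * metric σ e x = minkowski σ * (coframe e x)ᵀ := by
  rw [metric_eq_mul, ← Matrix.mul_assoc, ← Matrix.mul_assoc, frame_mul_coframe h, Matrix.one_mul]

lemma inv_metric_mul (hσ : σ = 1 ∨ σ = -1) (h : (e x).det ≠ 0) :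
    (e x)ᵀ * minkowski σ * e x * metric σ e x = 1 := by
  rw [Matrix.mul_assoc, frame_mul_metric h, Matrix.mul_assoc, ← Matrix.mul_assoc (minkowski σ),
    minkowski_mul_self hσ, Matrix.one_mul, ← Matrix.transpose_mul, coframe_mul_frame h,
    Matrix.transpose_one]

lemma metric_inv (hσ : σ = 1 ∨ σ = -1) (h : (e x).det ≠ 0) :
    (metric σ e x)⁻¹ = (e x)ᵀ * minkowski σ * e x :=
  Matrix.inv_eq_left_inv (inv_metric_mul hσ h)

lemma metric_mul_inv (hσ : σ = 1 ∨ σ = -1) (h : (e x).det ≠ 0) :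
    metric σ e x * (metric σ e x)⁻¹ = 1 := by
  rw [metric_inv hσ h]
  exact mul_eq_one_comm.1 (inv_metric_mul hσ h)

variable {μ : Fin 4}

/-- The derivative of the dual tetrad. -/
lemma frame_mul_pdMatrix_coframe (he : DiffEntries e x) (h : (e x).det ≠ 0) :
    e x * pdMatrix μ (coframe e) x = -(pdMatrix μ e x * coframe e x) := by
  have h1 : pdMatrix μ (fun z => e z * coframe e z) x = 0 := by
    rw [← pdMatrix_const (x := x) (μ := μ) (1 : Matrix (Fin 4) (Fin 4) ℝ)]
    ext i j
    refine pd_congr ?_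
    filter_upwards [he.det.continuousAt.eventually_ne h] with z hz
    rw [frame_mul_coframe hz]
  rw [pdMatrix_mul (N := coframe e) he (he.inv h)] at h1
  exact eq_neg_of_add_eq_zero_right h1

lemma pdMatrix_metric (he : DiffEntries e x) (h : (e x).det ≠ 0) :
    pdMatrix μ (metric σ e) x = pdMatrix μ (coframe e) x * minkowski σ * (coframe e x)ᵀ
      + coframe e x * minkowski σ * (pdMatrix μ (coframe e) x)ᵀ := by
  have hE : DiffEntries (coframe e) x := he.inv h
  rw [show metric σ e = fun z => coframe e z * minkowski σ * (coframe e z)ᵀ from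
    funext fun z => metric_eq_mul σ e z]
  rw [pdMatrix_mul (hE.mul (DiffEntries.const _)) hE.transpose,
    pdMatrix_mul hE (DiffEntries.const _), pdMatrix_const, Matrix.mul_zero, add_zero,
    pdMatrix_transpose]

lemma pdMatrix_metric_transpose :
    (pdMatrix μ (metric σ e) x)ᵀ = pdMatrix μ (metric σ e) x := by
  rw [← pdMatrix_transpose]
  simp only [metric_transpose]

lemma pdMatrix_metric_comm (α β : Fin 4) :
    pdMatrix μ (metric σ e) x α β = pdMatrix μ (metric σ e) x β α := by
  conv_lhs => rw [← pdMatrix_metric_transpose, Matrix.transpose_apply]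

lemma metric_comm (α β : Fin 4) : metric σ e x α β = metric σ e x β α := by
  conv_lhs => rw [← metric_transpose, Matrix.transpose_apply]

/-- The Christoffel symbols with lowered index. -/
lemma sum_metric_mul_christoffel (hσ : σ = 1 ∨ σ = -1) (h : (e x).det ≠ 0) (α μ ν : Fin 4) :
    ∑ β, metric σ e x β α * christoffel σ e β μ ν x
      = (1 / 2 : ℝ) * (pdMatrix μ (metric σ e) x ν α + pdMatrix ν (metric σ e) x μ α
        - pdMatrix α (metric σ e) x μ ν) := by
  set v : Fin 4 → ℝ := fun κ => pdMatrix μ (metric σ e) x ν κ + pdMatrix ν (metric σ e) x μ κ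
        - pdMatrix κ (metric σ e) x μ ν
  have h1 : ∀ β, christoffel σ e β μ ν x = (1 / 2 : ℝ) * ((metric σ e x)⁻¹ *ᵥ v) β :=
    fun β => rfl
  have h2 : (metric σ e x *ᵥ ((metric σ e x)⁻¹ *ᵥ v)) α = v α := by
    rw [Matrix.mulVec_mulVec, metric_mul_inv hσ h, Matrix.one_mulVec]
  change _ = (1 / 2 : ℝ) * v α
  rw [← h2, Matrix.mulVec, dotProduct, Finset.mul_sum]
  refine Finset.sum_congr rfl fun β _ => ?_
  rw [h1, metric_comm]
  ring

/-- The contracted Christoffel symbols are the logarithmic derivatives of the volume factor. -/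
lemma sum_christoffel (hσ : σ = 1 ∨ σ = -1) (he : DiffEntries e x) (h : (e x).det ≠ 0)
    (lam : Fin 4) :
    ∑ ν, christoffel σ e ν ν lam x = -(coframe e x * pdMatrix lam e x).trace := by
  have h1 : ∑ ν, christoffel σ e ν ν lam x
      = (1 / 2 : ℝ) * ((metric σ e x)⁻¹ * pdMatrix lam (metric σ e) x).trace := by
    have hG : ∀ α β, (metric σ e x)⁻¹ α β = (metric σ e x)⁻¹ β α := by
      intro α β
      rw [← Matrix.transpose_apply (metric σ e x)⁻¹, Matrix.transpose_nonsing_inv,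
        metric_transpose]
    -- the other two terms of the Christoffel symbol cancel by symmetry of the inverse metric
    have hc : ∑ ν, ∑ κ, (metric σ e x)⁻¹ ν κ * pdMatrix ν (metric σ e) x lam κ
        = ∑ ν, ∑ κ, (metric σ e x)⁻¹ ν κ * pdMatrix κ (metric σ e) x ν lam := by
      rw [Finset.sum_comm]
      refine Finset.sum_congr rfl fun ν _ => Finset.sum_congr rfl fun κ _ => ?_
      rw [hG, pdMatrix_metric_comm]
    have hd : ((metric σ e x)⁻¹ * pdMatrix lam (metric σ e) x).trace
        = ∑ ν, ∑ κ, (metric σ e x)⁻¹ ν κ * pdMatrix lam (metric σ e) x ν κ := by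
      simp only [Matrix.trace, Matrix.diag_apply, Matrix.mul_apply]
      refine Finset.sum_congr rfl fun ν _ => Finset.sum_congr rfl fun κ _ => ?_
      rw [pdMatrix_metric_comm]
    have hs : ∀ ν, christoffel σ e ν ν lam x = (1 / 2 : ℝ) *
        (∑ κ, (metric σ e x)⁻¹ ν κ * pdMatrix ν (metric σ e) x lam κ
          + ∑ κ, (metric σ e x)⁻¹ ν κ * pdMatrix lam (metric σ e) x ν κ
          - ∑ κ, (metric σ e x)⁻¹ ν κ * pdMatrix κ (metric σ e) x ν lam) := by
      intro ν
      rw [christoffel, ← Finset.sum_add_distrib, ← Finset.sum_sub_distrib]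
      congr 1
      refine Finset.sum_congr rfl fun κ _ => ?_
      simp only [pdMatrix, Matrix.of_apply]
      ring
    simp only [hs]
    rw [← Finset.mul_sum, Finset.sum_sub_distrib, Finset.sum_add_distrib, hc, hd]
    ring
  have h2 : (e x * pdMatrix lam (coframe e) x).trace
      = -(coframe e x * pdMatrix lam e x).trace := by
    rw [frame_mul_pdMatrix_coframe he h, Matrix.trace_neg, Matrix.trace_mul_comm]
  have h3 : ((metric σ e x)⁻¹ * (pdMatrix lam (coframe e) x * minkowski σ * (coframe e x)ᵀ)).trace
      = (e x * pdMatrix lam (coframe e) x).trace := by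
    rw [metric_inv hσ h, ← Matrix.mul_assoc, Matrix.trace_mul_comm]
    simp only [← Matrix.mul_assoc]
    rw [← Matrix.transpose_mul, frame_mul_coframe h, Matrix.transpose_one, Matrix.one_mul,
      Matrix.trace_mul_comm]
    simp only [← Matrix.mul_assoc]
    rw [minkowski_mul_self hσ, Matrix.one_mul]
  have h4 : ((metric σ e x)⁻¹ * (coframe e x * minkowski σ * (pdMatrix lam (coframe e) x)ᵀ)).trace
      = (e x * pdMatrix lam (coframe e) x).trace := by
    rw [metric_inv hσ h]
    simp only [Matrix.mul_assoc]
    rw [← Matrix.mul_assoc (e x) (coframe e x), frame_mul_coframe h, Matrix.one_mul,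
      ← Matrix.mul_assoc (minkowski σ), minkowski_mul_self hσ, Matrix.one_mul,
      ← Matrix.transpose_mul, Matrix.trace_transpose, Matrix.trace_mul_comm]
  rw [h1, pdMatrix_metric he h, Matrix.mul_add, Matrix.trace_add, h3, h4, h2]
  ring

/-- The divergence of the tetrad vector `e_A`, in the form `√(-g) ∇_μ e_A^μ = ∂_μ (√(-g) e_A^μ)`. -/
lemma sum_pd_sqrtNegDet_mul_frame (hσ : σ = 1 ∨ σ = -1) (he : DiffEntries e x)
    (h : (e x).det ≠ 0) (A : Fin 4) :
    ∑ μ, pd μ (fun z => sqrtNegDet σ e z * e z A μ) x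
      = sqrtNegDet σ e x * ∑ μ, covDerivFrame σ e μ A μ x := by
  have hd := he.det
  -- near `x` the determinant keeps its sign `s`
  obtain ⟨s, hs⟩ : ∃ s : ℝ, ∀ᶠ z in 𝓝 x, sqrtNegDet σ e z = s * ((e z).det)⁻¹ := by
    rcases lt_or_gt_of_ne h with h0 | h0
    · refine ⟨-1, ?_⟩
      filter_upwards [hd.continuousAt.eventually_lt continuousAt_const h0] with z hz
      rw [sqrtNegDet_eq hσ, abs_of_neg hz, inv_neg, neg_one_mul]
    · refine ⟨1, ?_⟩
      filter_upwards [continuousAt_const.eventually_lt hd.continuousAt h0] with z hz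
      rw [sqrtNegDet_eq hσ, abs_of_pos hz, one_mul]
  have hinv : DifferentiableAt ℝ (fun z => ((e z).det)⁻¹) x := hd.inv h
  have hdiff : DifferentiableAt ℝ (sqrtNegDet σ e) x :=
    (hinv.const_mul s).congr_of_eventuallyEq hs
  have hpd : ∀ μ, pd μ (sqrtNegDet σ e) x
      = -(sqrtNegDet σ e x * (coframe e x * pdMatrix μ e x).trace) := by
    intro μ
    rw [pd_congr hs, pd_mul (differentiableAt_const s) hinv, pd_const, zero_mul, zero_add,
      hs.self_of_nhds]
    have : pd μ (fun z => ((e z).det)⁻¹) x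
        = -(((e x).det ^ 2)⁻¹ * pd μ (fun z => (e z).det) x) := by
      have h5 := ((hasDerivAt_inv h).comp_hasFDerivAt x hd.hasFDerivAt).fderiv
      simp only [pd]
      rw [show (fun z => ((e z).det)⁻¹) = (fun y => y⁻¹) ∘ (fun z => (e z).det) from rfl, h5]
      simp
    rw [this, pd_det he, coframe, Matrix.inv_def, Ring.inverse_eq_inv', Matrix.smul_mul,
      Matrix.trace_smul, smul_eq_mul]
    field_simp
  have hmul : ∀ μ, pd μ (fun z => sqrtNegDet σ e z * e z A μ) x
      = sqrtNegDet σ e x * (pd μ (fun z => e z A μ) x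
        - (coframe e x * pdMatrix μ e x).trace * e x A μ) := by
    intro μ
    rw [pd_mul hdiff (he A μ), hpd]
    ring
  simp only [hmul, covDerivFrame]
  rw [← Finset.mul_sum, Finset.sum_sub_distrib, Finset.sum_add_distrib]
  rw [Finset.sum_comm (f := fun μ ν => christoffel σ e μ μ ν x * e x A ν)]
  simp only [← Finset.sum_mul, sum_christoffel hσ he h]
  simp only [neg_mul, Finset.sum_neg_distrib, sub_eq_add_neg]

/-- The spin connection coefficients as a matrix product. -/
lemma spinConnection_eq_mul (A B μ : Fin 4) :
    spinConnection σ e A B μ x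
      = (e x * metric σ e x * (Matrix.of fun B β => covDerivFrame σ e μ B β x)ᵀ) A B := by
  simp only [spinConnection, Matrix.mul_apply, Matrix.transpose_apply, Matrix.of_apply,
    Finset.sum_mul]
  rw [Finset.sum_comm]
  refine Finset.sum_congr rfl fun β _ => Finset.sum_congr rfl fun α _ => ?_
  rw [metric_comm]
  ring

/-- The expansion `∇_μ e_B^β = η^{DA} ω_{ABμ} e_D^β` of the derivative of the tetrad. -/
lemma sum_spinConnection_mul_frame (hσ : σ = 1 ∨ σ = -1) (h : (e x).det ≠ 0) (B μ β : Fin 4) :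
    ∑ D, ∑ A, e x D β * minkowski σ D A * spinConnection σ e A B μ x
      = covDerivFrame σ e μ B β x := by
  have h1 : ((e x)ᵀ * minkowski σ * e x * metric σ e x *
      (Matrix.of fun B β => covDerivFrame σ e μ B β x)ᵀ) β B = covDerivFrame σ e μ B β x := by
    rw [inv_metric_mul hσ h, Matrix.one_mul]
    rfl
  rw [← h1, Matrix.mul_assoc _ (e x), Matrix.mul_assoc _ (e x * _), Matrix.mul_apply]
  simp only [← spinConnection_eq_mul]
  simp only [Matrix.mul_apply (M := (e x)ᵀ), Matrix.transpose_apply, Finset.sum_mul]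
  rw [Finset.sum_comm]

/-- The Levi-Civita connection is metric, so the spin connection is antisymmetric. -/
lemma spinConnection_antisymm (hσ : σ = 1 ∨ σ = -1) (he : DiffEntries e x) (h : (e x).det ≠ 0)
    (A B μ : Fin 4) : spinConnection σ e A B μ x = -spinConnection σ e B A μ x := by
  -- `L α ν` is the Christoffel symbol `Γ_{αμν}` with the first index lowered
  set L : Matrix (Fin 4) (Fin 4) ℝ := Matrix.of fun α ν =>
    (1 / 2 : ℝ) * (pdMatrix μ (metric σ e) x ν α + pdMatrix ν (metric σ e) x μ α
        - pdMatrix α (metric σ e) x μ ν) with hL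
  have hLL : L + Lᵀ = pdMatrix μ (metric σ e) x := by
    ext α ν
    simp only [hL, Matrix.add_apply, Matrix.transpose_apply, Matrix.of_apply]
    rw [pdMatrix_metric_comm (μ := μ) ν α, pdMatrix_metric_comm (μ := ν) μ α,
      pdMatrix_metric_comm (μ := α) μ ν]
    ring
  have hcov : (Matrix.of fun B β => covDerivFrame σ e μ B β x)
      = pdMatrix μ e x + e x * (Matrix.of fun β ν => christoffel σ e β μ ν x)ᵀ := by
    ext B β
    simp only [covDerivFrame, pdMatrix, Matrix.add_apply, Matrix.mul_apply, Matrix.of_apply,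
      Matrix.transpose_apply]
    congr 1
    exact Finset.sum_congr rfl fun ν _ => mul_comm _ _
  have hlow : metric σ e x * (Matrix.of fun β ν => christoffel σ e β μ ν x) = L := by
    ext α ν
    rw [hL, Matrix.of_apply, ← sum_metric_mul_christoffel hσ h, Matrix.mul_apply]
    refine Finset.sum_congr rfl fun β _ => ?_
    rw [metric_comm]
    rfl
  set W : Matrix (Fin 4) (Fin 4) ℝ := e x * metric σ e x *
    (Matrix.of fun B β => covDerivFrame σ e μ B β x)ᵀ with hW
  have hW' : W = minkowski σ * (pdMatrix μ e x * coframe e x)ᵀ + e x * L * (e x)ᵀ := by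
    rw [hW, hcov, Matrix.transpose_add, Matrix.mul_add, Matrix.transpose_mul,
      Matrix.transpose_transpose, ← hlow]
    congr 1
    · rw [frame_mul_metric h, Matrix.mul_assoc, ← Matrix.transpose_mul]
    · simp only [Matrix.mul_assoc]
  have hz : W + Wᵀ = 0 := by
    rw [hW', Matrix.transpose_add, Matrix.transpose_mul (minkowski σ),
      Matrix.transpose_transpose, Matrix.transpose_mul (e x * L), Matrix.transpose_transpose,
      Matrix.transpose_mul (e x) L, minkowski_transpose]
    have h6 : e x * L * (e x)ᵀ + e x * (Lᵀ * (e x)ᵀ)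
        = e x * pdMatrix μ (metric σ e) x * (e x)ᵀ := by
      rw [← hLL, Matrix.mul_add, Matrix.add_mul, Matrix.mul_assoc (e x) Lᵀ]
    have h7 : e x * pdMatrix μ (metric σ e) x * (e x)ᵀ
        = -(pdMatrix μ e x * coframe e x) * minkowski σ
          - minkowski σ * (pdMatrix μ e x * coframe e x)ᵀ := by
      rw [pdMatrix_metric he h, Matrix.mul_add, Matrix.add_mul]
      simp only [← Matrix.mul_assoc]
      rw [frame_mul_pdMatrix_coframe he h, frame_mul_coframe h, Matrix.one_mul]
      rw [Matrix.mul_assoc _ (coframe e x)ᵀ, ← Matrix.transpose_mul, frame_mul_coframe h,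
        Matrix.transpose_one, Matrix.mul_one, Matrix.mul_assoc _ _ (e x)ᵀ, ← Matrix.transpose_mul,
        frame_mul_pdMatrix_coframe he h, Matrix.transpose_neg, Matrix.mul_neg, sub_eq_add_neg]
    rw [show ∀ a b c d : Matrix (Fin 4) (Fin 4) ℝ, a + b + (c + d) = a + c + (b + d) from
      fun a b c d => add_add_add_comm a b c d, h6, h7]
    noncomm_ring
  rw [spinConnection_eq_mul, spinConnection_eq_mul, eq_neg_iff_add_eq_zero]
  exact congrFun (congrFun hz A) B

end LeviCivita

/-! ### The Dirac current and its divergence -/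

section Current

variable {ε σ : ℝ} {γ : Fin 4 → Matrix (Fin 4) (Fin 4) ℂ}

/-- The commutator of a bivector with a gamma matrix is a vector. -/
lemma IsGammaRep.commutator (hγ : IsGammaRep ε σ γ) (A B D : Fin 4) :
    γ A * γ B * γ D - γ D * (γ A * γ B)
      = ((2 * ε * minkowski σ B D : ℝ) : ℂ) • γ A - ((2 * ε * minkowski σ A D : ℝ) : ℂ) • γ B := by
  have h1 := congrArg (γ A * ·) (hγ.anticomm B D)
  have h2 := congrArg (· * γ B) (hγ.anticomm A D)
  simp only [Matrix.mul_smul, Matrix.smul_mul, Matrix.mul_one, Matrix.one_mul] at h1 h2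
  rw [← h1, ← h2]
  noncomm_ring

lemma IsGammaRep.zero_mul_zero (hγ : IsGammaRep ε σ γ) :
    γ 0 * γ 0 = ((ε * σ : ℝ) : ℂ) • 1 := by
  have h := hγ.anticomm 0 0
  rw [← two_smul ℂ (γ 0 * γ 0)] at h
  have h2 : (2 : ℂ) • (γ 0 * γ 0) = (2 : ℂ) • (((ε * σ : ℝ) : ℂ) • (1 : Matrix _ _ ℂ)) := by
    rw [h, smul_smul]
    congr 1
    simp [minkowski, mul_assoc]
  exact smul_right_injective _ (two_ne_zero) h2

lemma diracAdjoint_apply (γ : Fin 4 → Matrix (Fin 4) (Fin 4) ℂ) (φ : Spinor) (i : Fin 4) :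
    diracAdjoint γ φ i = ∑ j, star (φ j) * γ 0 j i := rfl

lemma differentiableAt_diracAdjoint {φ : (Fin 4 → ℝ) → Spinor} {x : Fin 4 → ℝ}
    (hφ : DifferentiableAt ℝ φ x) : DifferentiableAt ℝ (fun z => diracAdjoint γ (φ z)) x := by
  rw [differentiableAt_pi] at hφ ⊢
  intro i
  simp only [diracAdjoint_apply]
  exact DifferentiableAt.fun_sum fun j _ => (hφ j).star.mul_const _

lemma pd_diracAdjoint {φ : (Fin 4 → ℝ) → Spinor} {x : Fin 4 → ℝ}
    (hφ : DifferentiableAt ℝ φ x) (μ : Fin 4) :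
    pd μ (fun z => diracAdjoint γ (φ z)) x = diracAdjoint γ (pd μ φ x) := by
  ext i
  have hφ' := differentiableAt_pi.1 hφ
  rw [pd_apply (differentiableAt_diracAdjoint hφ)]
  simp only [diracAdjoint_apply]
  rw [pd_sum fun j _ => (hφ' j).star.mul_const _]
  refine Finset.sum_congr rfl fun j _ => ?_
  rw [pd_mul (hφ' j).star (differentiableAt_const _), pd_const, mul_zero, add_zero,
    pd_apply hφ]
  congr 1
  simp only [pd]
  rw [fderiv_star]
  rfl

variable {e : (Fin 4 → ℝ) → Matrix (Fin 4) (Fin 4) ℝ} {x : Fin 4 → ℝ}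

/-- `Γ_μ† γ^0 = - γ^0 Γ_μ`: the Dirac adjoint is compatible with the spinor connection. -/
lemma conjTranspose_spinorConnection_mul (hγ : IsGammaRep ε σ γ) (he : DiffEntries e x)
    (h : (e x).det ≠ 0) (μ : Fin 4) :
    (spinorConnection ε σ γ e μ x)ᴴ * γ 0 = -(γ 0 * spinorConnection ε σ γ e μ x) := by
  have hes : (ε * σ) * (ε * σ) = 1 := by
    rcases hγ.sign_eq with rfl | rfl <;> rcases hγ.signature_eq with rfl | rfl <;> norm_num
  have h1 : ∀ A B, (γ A * γ B)ᴴ * γ 0 = γ 0 * (γ B * γ A) := by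
    intro A B
    rw [Matrix.conjTranspose_mul, hγ.herm, hγ.herm]
    calc γ 0 * γ B * γ 0 * (γ 0 * γ A * γ 0) * γ 0
        = γ 0 * γ B * (γ 0 * γ 0) * γ A * (γ 0 * γ 0) := by noncomm_ring
      _ = γ 0 * (γ B * γ A) := by
        rw [hγ.zero_mul_zero]
        simp only [Matrix.mul_smul, Matrix.smul_mul, Matrix.mul_one, smul_smul]
        rw [← Complex.ofReal_mul, hes, Complex.ofReal_one, one_smul, Matrix.mul_assoc]
  simp only [spinorConnection, Matrix.conjTranspose_sum, Matrix.conjTranspose_smul,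
    Finset.sum_mul, Finset.mul_sum, Matrix.smul_mul, Matrix.mul_smul, h1]
  rw [Finset.sum_comm, ← Finset.sum_neg_distrib]
  refine Finset.sum_congr rfl fun A _ => ?_
  rw [← Finset.sum_neg_distrib]
  refine Finset.sum_congr rfl fun B _ => ?_
  rw [spinConnection_antisymm hγ.signature_eq he h B A, ← neg_smul]
  congr 1
  simp

lemma adjointD_eq (hγ : IsGammaRep ε σ γ) (he : DiffEntries e x) (h : (e x).det ≠ 0)
    {φ : (Fin 4 → ℝ) → Spinor} (hφ : DifferentiableAt ℝ φ x) (μ : Fin 4) :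
    adjointD ε σ γ e φ μ x = diracAdjoint γ (spinorD ε σ γ e φ μ x) := by
  have h1 : diracAdjoint γ (φ x) ᵥ* spinorConnection ε σ γ e μ x
      = -diracAdjoint γ (spinorConnection ε σ γ e μ x *ᵥ φ x) := by
    rw [diracAdjoint, diracAdjoint, Matrix.star_mulVec, Matrix.vecMul_vecMul,
      Matrix.vecMul_vecMul, conjTranspose_spinorConnection_mul hγ he h, Matrix.vecMul_neg, neg_neg]
  rw [adjointD, pd_diracAdjoint hφ, h1, spinorD, diracAdjoint, diracAdjoint, diracAdjoint,
    star_add, Matrix.add_vecMul, sub_neg_eq_add]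

/-- The Dirac equation for `φ` implies the adjoint equation for `φ̄`. -/
lemma DiracEqAt.adjoint (hγ : IsGammaRep ε σ γ) (he : DiffEntries e x) (h : (e x).det ≠ 0)
    {m : ℝ} {φ : (Fin 4 → ℝ) → Spinor} (hφ : DifferentiableAt ℝ φ x)
    (hD : DiracEqAt ε σ γ m e φ x) : AdjointDiracEqAt ε σ γ m e φ x := by
  -- both conventions: conjugation changes the sign of the factor exactly if `(γ^0)² = I`
  have hk : star (diracFactor ε σ) * ((ε * σ : ℝ) : ℂ) = -diracFactor ε σ := by
    unfold diracFactor
    rcases hγ.sign_eq with rfl | rfl <;> rcases hγ.signature_eq with rfl | rfl <;> norm_num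
  have hbar : ∀ μ, (gammaBar γ e μ x)ᴴ * γ 0 = ((ε * σ : ℝ) : ℂ) • (γ 0 * gammaBar γ e μ x) := by
    intro μ
    simp only [gammaBar, Matrix.conjTranspose_sum, Matrix.conjTranspose_smul, Finset.sum_mul,
      Finset.mul_sum, Finset.smul_sum]
    refine Finset.sum_congr rfl fun A _ => ?_
    rw [hγ.herm, Matrix.smul_mul, Matrix.mul_assoc, hγ.zero_mul_zero, Matrix.mul_smul,
      Matrix.mul_one, Matrix.mul_smul, smul_comm]
    simp
  have h1 := congrArg (diracAdjoint γ) (sub_eq_zero.1 hD)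
  simp only [diracAdjoint, star_smul, star_sum, Matrix.star_mulVec, Matrix.smul_vecMul,
    Matrix.sum_vecMul, Matrix.vecMul_vecMul, hbar, Matrix.vecMul_smul] at h1
  rw [← Finset.smul_sum, smul_smul, hk] at h1
  rw [AdjointDiracEqAt]
  simp only [adjointD_eq hγ he h hφ, diracAdjoint, Matrix.vecMul_vecMul]
  rw [neg_smul] at h1
  rw [← Matrix.smul_vecMul, show (m : ℂ) = star (m : ℂ) by simp, Matrix.smul_vecMul, ← h1,
    add_neg_cancel]

/-- Covariant constancy of the gamma matrices, `∇_μ γ̄^μ + [Γ_μ, γ̄^μ] = 0`. -/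
lemma sum_commutator_spinorConnection (hγ : IsGammaRep ε σ γ) (he : DiffEntries e x)
    (h : (e x).det ≠ 0) :
    ∑ μ, (spinorConnection ε σ γ e μ x * gammaBar γ e μ x
        - gammaBar γ e μ x * spinorConnection ε σ γ e μ x)
      = -∑ B, ((∑ μ, covDerivFrame σ e μ B μ x : ℝ) : ℂ) • γ B := by
  have hε : ε * ε = 1 := by rcases hγ.sign_eq with rfl | rfl <;> norm_num
  have hω := spinConnection_antisymm hγ.signature_eq he h
  have h1 : ∀ μ D, spinorConnection ε σ γ e μ x * γ D - γ D * spinorConnection ε σ γ e μ x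
      = -∑ B, ((∑ A, minkowski σ D A * spinConnection σ e A B μ x : ℝ) : ℂ) • γ B := by
    intro μ D
    have h2 : spinorConnection ε σ γ e μ x * γ D - γ D * spinorConnection ε σ γ e μ x
        = ∑ A, ∑ B, ((ε / 4 * spinConnection σ e A B μ x : ℝ) : ℂ) •
          (((2 * ε * minkowski σ B D : ℝ) : ℂ) • γ A
            - ((2 * ε * minkowski σ A D : ℝ) : ℂ) • γ B) := by
      simp only [spinorConnection, Finset.sum_mul, Finset.mul_sum, Matrix.smul_mul,
        Matrix.mul_smul, ← Finset.sum_sub_distrib, ← smul_sub, hγ.commutator]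
    -- by antisymmetry of `ω` the two terms of the commutator contribute equally
    have h3 : ∑ A, ∑ B, ((ε / 4 * spinConnection σ e A B μ x : ℝ) : ℂ) •
          (((2 * ε * minkowski σ B D : ℝ) : ℂ) • γ A)
        = -∑ A, ∑ B, ((1 / 2 * (minkowski σ D A * spinConnection σ e A B μ x) : ℝ) : ℂ) • γ B := by
      rw [Finset.sum_comm, ← Finset.sum_neg_distrib]
      refine Finset.sum_congr rfl fun A _ => ?_
      rw [← Finset.sum_neg_distrib]
      refine Finset.sum_congr rfl fun B _ => ?_
      rw [smul_smul, ← neg_smul, ← Complex.ofReal_mul, ← Complex.ofReal_neg, hω B A,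
        minkowski_comm σ A D]
      congr 2
      linear_combination (-(1 / 2) * spinConnection σ e A B μ x * minkowski σ D A) * hε
    have h4 : ∑ A, ∑ B, ((ε / 4 * spinConnection σ e A B μ x : ℝ) : ℂ) •
          (((2 * ε * minkowski σ A D : ℝ) : ℂ) • γ B)
        = ∑ A, ∑ B, ((1 / 2 * (minkowski σ D A * spinConnection σ e A B μ x) : ℝ) : ℂ) • γ B := by
      refine Finset.sum_congr rfl fun A _ => Finset.sum_congr rfl fun B _ => ?_
      rw [smul_smul, ← Complex.ofReal_mul, minkowski_comm σ A D]
      congr 2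
      linear_combination ((1 / 2) * spinConnection σ e A B μ x * minkowski σ D A) * hε
    rw [h2]
    simp only [smul_sub, Finset.sum_sub_distrib]
    rw [h3, h4, Finset.sum_comm, ← neg_add', ← Finset.sum_add_distrib]
    congr 1
    refine Finset.sum_congr rfl fun B _ => ?_
    rw [← Finset.sum_add_distrib, Complex.ofReal_sum, Finset.sum_smul]
    refine Finset.sum_congr rfl fun A _ => ?_
    rw [← add_smul, ← Complex.ofReal_add]
    congr 2
    ring
  have h5 : ∀ μ, spinorConnection ε σ γ e μ x * gammaBar γ e μ x
        - gammaBar γ e μ x * spinorConnection ε σ γ e μ x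
      = -∑ B, ((covDerivFrame σ e μ B μ x : ℝ) : ℂ) • γ B := by
    intro μ
    simp only [gammaBar, Finset.sum_mul, Finset.mul_sum, Matrix.smul_mul, Matrix.mul_smul,
      ← Finset.sum_sub_distrib, ← smul_sub, h1]
    simp only [smul_neg, Finset.sum_neg_distrib, Finset.smul_sum]
    rw [Finset.sum_comm]
    congr 1
    refine Finset.sum_congr rfl fun B _ => ?_
    rw [← sum_spinConnection_mul_frame hγ.signature_eq h B μ μ, Complex.ofReal_sum,
      Finset.sum_smul]
    refine Finset.sum_congr rfl fun D _ => ?_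
    rw [smul_smul, ← Complex.ofReal_mul, Finset.mul_sum]
    simp only [mul_assoc]
  simp only [h5, Finset.sum_neg_distrib, Complex.ofReal_sum, Finset.sum_smul]
  rw [Finset.sum_comm]

lemma differentiableAt_dotProduct_mulVec {u v : (Fin 4 → ℝ) → Spinor}
    (M : Matrix (Fin 4) (Fin 4) ℂ) (hu : DifferentiableAt ℝ u x) (hv : DifferentiableAt ℝ v x) :
    DifferentiableAt ℝ (fun z => u z ⬝ᵥ (M *ᵥ v z)) x := by
  simp only [dotProduct, Matrix.mulVec]
  rw [differentiableAt_pi] at hu hv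
  exact DifferentiableAt.fun_sum fun i _ => (hu i).mul <|
    DifferentiableAt.fun_sum fun j _ => (hv j).const_mul _

lemma pd_dotProduct_mulVec {u v : (Fin 4 → ℝ) → Spinor} (M : Matrix (Fin 4) (Fin 4) ℂ)
    (hu : DifferentiableAt ℝ u x) (hv : DifferentiableAt ℝ v x) (μ : Fin 4) :
    pd μ (fun z => u z ⬝ᵥ (M *ᵥ v z)) x
      = pd μ u x ⬝ᵥ (M *ᵥ v x) + u x ⬝ᵥ (M *ᵥ pd μ v x) := by
  have hu' := differentiableAt_pi.1 hu
  have hv' := differentiableAt_pi.1 hv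
  have h1 : ∀ i, DifferentiableAt ℝ (fun z => ∑ j, M i j * v z j) x := fun i =>
    DifferentiableAt.fun_sum fun j _ => (hv' j).const_mul _
  simp only [dotProduct, Matrix.mulVec]
  rw [pd_sum fun i _ => (hu' i).fun_mul (h1 i), ← Finset.sum_add_distrib]
  refine Finset.sum_congr rfl fun i _ => ?_
  rw [pd_mul (hu' i) (h1 i), pd_sum fun j _ => (hv' j).const_mul _, pd_apply hu]
  congr 2
  refine Finset.sum_congr rfl fun j _ => ?_
  rw [pd_mul (differentiableAt_const _) (hv' j), pd_const, zero_mul, zero_add, pd_apply hv]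

lemma differentiableAt_sqrtNegDet (hσ : σ = 1 ∨ σ = -1) (he : DiffEntries e x)
    (h : (e x).det ≠ 0) : DifferentiableAt ℝ (sqrtNegDet σ e) x := by
  rw [funext (sqrtNegDet_eq hσ e)]
  exact ((he.det.abs h).inv (abs_ne_zero.2 h))

/-- The current of two solutions of the Dirac equation is divergence free. -/
theorem sum_pd_current (hγ : IsGammaRep ε σ γ) (he : DiffEntries e x) (h : (e x).det ≠ 0)
    {m : ℝ} {φ ψ : (Fin 4 → ℝ) → Spinor} (hφ : DifferentiableAt ℝ φ x)
    (hψ : DifferentiableAt ℝ ψ x) (hDψ : DiracEqAt ε σ γ m e ψ x)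
    (hDφ : AdjointDiracEqAt ε σ γ m e φ x) :
    ∑ μ, pd μ (fun z => (sqrtNegDet σ e z : ℂ) *
      (diracAdjoint γ (φ z) ⬝ᵥ (gammaBar γ e μ z *ᵥ ψ z))) x = 0 := by
  have hσ := hγ.signature_eq
  have hφ' := differentiableAt_diracAdjoint (γ := γ) hφ
  -- the bilinears `φ̄ γ^A ψ`, from which the current arises by contraction with the tetrad
  set q : Fin 4 → (Fin 4 → ℝ) → ℂ := fun A z => diracAdjoint γ (φ z) ⬝ᵥ (γ A *ᵥ ψ z) with hq
  have hqd : ∀ A, DifferentiableAt ℝ (q A) x := fun A =>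
    differentiableAt_dotProduct_mulVec _ hφ' hψ
  have hsd : ∀ A μ, DifferentiableAt ℝ (fun z => sqrtNegDet σ e z * e z A μ) x := fun A μ =>
    (differentiableAt_sqrtNegDet hσ he h).mul (he A μ)
  have hsd' : ∀ A μ, DifferentiableAt ℝ (fun z => ((sqrtNegDet σ e z * e z A μ : ℝ) : ℂ)) x :=
    fun A μ => Complex.ofRealCLM.differentiableAt.comp x (hsd A μ)
  have hJ : ∀ μ, (fun z => (sqrtNegDet σ e z : ℂ) *
      (diracAdjoint γ (φ z) ⬝ᵥ (gammaBar γ e μ z *ᵥ ψ z)))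
      = fun z => ∑ A, ((sqrtNegDet σ e z * e z A μ : ℝ) : ℂ) * q A z := by
    intro μ
    funext z
    simp only [gammaBar, Matrix.sum_mulVec, dotProduct_sum, Finset.mul_sum, Matrix.smul_mulVec,
      dotProduct_smul, smul_eq_mul, hq, Complex.ofReal_mul, mul_assoc]
  have hpd : ∀ μ, pd μ (fun z => (sqrtNegDet σ e z : ℂ) *
      (diracAdjoint γ (φ z) ⬝ᵥ (gammaBar γ e μ z *ᵥ ψ z))) x
      = ∑ A, ((pd μ (fun z => sqrtNegDet σ e z * e z A μ) x : ℝ) : ℂ) * q A x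
        + (sqrtNegDet σ e x : ℂ) * ∑ A, (e x A μ : ℂ) * pd μ (q A) x := by
    intro μ
    rw [hJ, pd_sum fun A _ => (hsd' A μ).fun_mul (hqd A), Finset.mul_sum, ← Finset.sum_add_distrib]
    refine Finset.sum_congr rfl fun A _ => ?_
    rw [pd_mul (hsd' A μ) (hqd A), pd_ofReal (hsd A μ)]
    push_cast
    ring
  set Φ : Fin 4 → Spinor := fun μ => adjointD ε σ γ e φ μ x with hΦ
  set Ψ : Fin 4 → Spinor := fun μ => spinorD ε σ γ e ψ μ x with hΨ
  have hadj : ∀ μ, pd μ (fun z => diracAdjoint γ (φ z)) x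
      = Φ μ + diracAdjoint γ (φ x) ᵥ* spinorConnection ε σ γ e μ x := fun μ => by
    simp [hΦ, adjointD]
  have hspin : ∀ μ, pd μ ψ x = Ψ μ - spinorConnection ε σ γ e μ x *ᵥ ψ x := fun μ => by
    simp [hΨ, spinorD]
  have hterm : ∀ μ, ∑ A, (e x A μ : ℂ) * pd μ (q A) x
      = (Φ μ ᵥ* gammaBar γ e μ x) ⬝ᵥ ψ x + diracAdjoint γ (φ x) ⬝ᵥ (gammaBar γ e μ x *ᵥ Ψ μ)
        + diracAdjoint γ (φ x) ⬝ᵥ ((spinorConnection ε σ γ e μ x * gammaBar γ e μ x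
        - gammaBar γ e μ x * spinorConnection ε σ γ e μ x) *ᵥ ψ x) := by
    intro μ
    have h1 : ∑ A, (e x A μ : ℂ) * pd μ (q A) x
        = pd μ (fun z => diracAdjoint γ (φ z)) x ⬝ᵥ (gammaBar γ e μ x *ᵥ ψ x)
          + diracAdjoint γ (φ x) ⬝ᵥ (gammaBar γ e μ x *ᵥ pd μ ψ x) := by
      simp only [hq, pd_dotProduct_mulVec _ hφ' hψ, gammaBar, Matrix.sum_mulVec, dotProduct_sum,
        Matrix.smul_mulVec, dotProduct_smul, smul_eq_mul, mul_add, Finset.sum_add_distrib]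
    rw [h1, hadj, hspin, add_dotProduct, Matrix.mulVec_sub, dotProduct_sub, Matrix.sub_mulVec,
      dotProduct_sub, ← Matrix.mulVec_mulVec, ← Matrix.mulVec_mulVec, ← Matrix.dotProduct_mulVec,
      ← Matrix.dotProduct_mulVec]
    ring
  have hsum : ∑ μ, ∑ A, (e x A μ : ℂ) * pd μ (q A) x
      = -∑ A, ((∑ μ, covDerivFrame σ e μ A μ x : ℝ) : ℂ) * q A x := by
    have hk : diracFactor ε σ ≠ 0 := by
      unfold diracFactor
      split_ifs <;> simp
    have h1 : ∑ μ, (Φ μ ᵥ* gammaBar γ e μ x) ⬝ᵥ ψ x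
        + ∑ μ, diracAdjoint γ (φ x) ⬝ᵥ (gammaBar γ e μ x *ᵥ Ψ μ) = 0 := by
      rw [← sum_dotProduct, ← dotProduct_sum]
      refine mul_left_cancel₀ hk ?_
      rw [mul_add, mul_zero, ← smul_eq_mul, ← smul_eq_mul, ← smul_dotProduct, ← dotProduct_smul]
      rw [sub_eq_zero.1 hDψ, eq_neg_of_add_eq_zero_left hDφ]
      simp
    simp only [hterm, Finset.sum_add_distrib]
    rw [h1, zero_add, ← dotProduct_sum, ← Matrix.sum_mulVec,
      sum_commutator_spinorConnection hγ he h]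
    simp only [Matrix.neg_mulVec, dotProduct_neg, Matrix.sum_mulVec, dotProduct_sum,
        Matrix.smul_mulVec, dotProduct_smul, smul_eq_mul, hq]
  simp only [hpd, Finset.sum_add_distrib]
  rw [← Finset.mul_sum, hsum, Finset.sum_comm]
  simp only [← Finset.sum_mul, ← Complex.ofReal_sum, sum_pd_sqrtNegDet_mul_frame hσ he h]
  rw [mul_neg, Finset.mul_sum, ← sub_eq_add_neg, ← Finset.sum_sub_distrib]
  refine Finset.sum_eq_zero fun A _ => ?_
  push_cast
  ring

end Current

/-! ### Conservation laws on `J × ℝ³` -/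

section Slices

/-- The point of `ℝ⁴` with time coordinate `q.1` and space coordinates `q.2`, as a linear map. -/
noncomputable def sliceMap : ℝ × E3 →L[ℝ] (Fin 4 → ℝ) :=
  ContinuousLinearMap.pi (Fin.cons (ContinuousLinearMap.fst ℝ ℝ E3)
    fun i => (EuclideanSpace.proj i : E3 →L[ℝ] ℝ) ∘L ContinuousLinearMap.snd ℝ ℝ E3)

lemma sliceMap_zero (q : ℝ × E3) : sliceMap q 0 = q.1 := rfl

lemma sliceMap_succ (q : ℝ × E3) (i : Fin 3) : sliceMap q i.succ = q.2 i := rfl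

lemma sliceMap_eq (t : ℝ) (y : E3) : sliceMap (t, y) = Fin.cons t (fun i => y i) := by
  ext μ
  refine Fin.cases ?_ (fun i => ?_) μ <;> rfl

lemma toLp_tail_sliceMap (q : ℝ × E3) : WithLp.toLp 2 (Fin.tail (sliceMap q)) = q.2 := rfl

lemma sliceMap_self (x : Fin 4 → ℝ) : sliceMap (x 0, WithLp.toLp 2 (Fin.tail x)) = x := by
  ext μ
  refine Fin.cases ?_ (fun i => ?_) μ <;> rfl

lemma sliceMap_time : sliceMap (1, 0) = Pi.single 0 1 := by
  ext μ
  refine Fin.cases ?_ (fun i => ?_) μ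
  · simp [sliceMap_zero]
  · simp [sliceMap_succ]

lemma sliceMap_space (i : Fin 3) :
    sliceMap (0, EuclideanSpace.single i 1) = Pi.single i.succ 1 := by
  ext μ
  refine Fin.cases ?_ (fun j => ?_) μ
  · simp [sliceMap_zero]
  · simp [sliceMap_succ, Pi.single_apply]

variable {J : Set ℝ} {K : Set E3}

lemma isOpen_timeSlab (hJ : IsOpen J) : IsOpen {x : Fin 4 → ℝ | x 0 ∈ J} :=
  hJ.preimage (continuous_apply 0)

lemma continuous_toLp_tail : Continuous fun x : Fin 4 → ℝ => (WithLp.toLp 2 (Fin.tail x) : E3) :=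
  (PiLp.continuous_toLp 2 _).comp (continuous_pi fun i => continuous_apply i.succ)

lemma continuousOn_pd {F : Type*} [NormedAddCommGroup F] [NormedSpace ℝ F]
    {f : (Fin 4 → ℝ) → F} {U : Set (Fin 4 → ℝ)} (hU : IsOpen U)
    (hf : ContDiffOn ℝ 1 f U) (μ : Fin 4) : ContinuousOn (pd μ f) U :=
  (hf.continuousOn_fderiv_of_isOpen hU le_rfl).clm_apply continuousOn_const

lemma pd_eq_zero_of_notMem (hJ : IsOpen J) (hK : IsCompact K) {f : (Fin 4 → ℝ) → ℂ}
    (hs : ∀ t ∈ J, ∀ y ∉ K, f (sliceMap (t, y)) = 0) (μ : Fin 4) {t : ℝ} (ht : t ∈ J) {y : E3}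
    (hy : y ∉ K) : pd μ f (sliceMap (t, y)) = 0 := by
  have h1 : f =ᶠ[𝓝 (sliceMap (t, y))] fun _ => 0 := by
    have h2 : {x : Fin 4 → ℝ | x 0 ∈ J} ∩ {x | WithLp.toLp 2 (Fin.tail x) ∈ Kᶜ}
        ∈ 𝓝 (sliceMap (t, y)) :=
      ((isOpen_timeSlab hJ).inter (hK.isClosed.isOpen_compl.preimage
        continuous_toLp_tail)).mem_nhds ⟨ht, hy⟩
    filter_upwards [h2] with x hx
    rw [← sliceMap_self x]
    exact hs _ hx.1 _ hx.2
  rw [pd_congr h1, pd_const]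

variable {f : (Fin 4 → ℝ) → ℂ}

lemma continuous_slice (hf : ContinuousOn f {x | x 0 ∈ J}) {t : ℝ} (ht : t ∈ J) :
    Continuous fun y : E3 => f (sliceMap (t, y)) := by
  rw [← continuousOn_univ]
  exact hf.comp ((sliceMap.continuous.comp (Continuous.prodMk_right t)).continuousOn)
    fun y _ => ht

lemma integrable_slice (hK : IsCompact K) (hf : ContinuousOn f {x | x 0 ∈ J})
    (hs : ∀ t ∈ J, ∀ y ∉ K, f (sliceMap (t, y)) = 0) {t : ℝ} (ht : t ∈ J) :
    Integrable fun y : E3 => f (sliceMap (t, y)) :=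
  (continuous_slice hf ht).integrable_of_hasCompactSupport
    (HasCompactSupport.intro hK fun y hy => hs t ht y hy)

lemma continuousOn_integral_slice (hK : IsCompact K) (hf : ContinuousOn f {x | x 0 ∈ J})
    (hs : ∀ t ∈ J, ∀ y ∉ K, f (sliceMap (t, y)) = 0) :
    ContinuousOn (fun t => ∫ y : E3, f (sliceMap (t, y))) J := by
  refine continuousOn_integral_of_compact_support (f := fun t y => f (sliceMap (t, y))) hK ?_
    fun t y ht hy => hs t ht y hy
  exact hf.comp sliceMap.continuous.continuousOn fun q hq => hq.1

lemma hasDerivAt_integral_slice (hJ : IsOpen J) (hK : IsCompact K)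
    (hf : ContDiffOn ℝ 1 f {x | x 0 ∈ J})
    (hs : ∀ t ∈ J, ∀ y ∉ K, f (sliceMap (t, y)) = 0) {t : ℝ} (ht : t ∈ J) :
    HasDerivAt (fun s => ∫ y : E3, f (sliceMap (s, y)))
      (∫ y : E3, pd 0 f (sliceMap (t, y))) t := by
  have hU := isOpen_timeSlab hJ
  have hc := continuousOn_pd hU hf 0
  obtain ⟨δ, hδ, hball⟩ := Metric.isOpen_iff.1 hJ t ht
  have hI : Metric.closedBall t (δ / 2) ⊆ J :=
    (Metric.closedBall_subset_ball (by linarith)).trans hball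
  have hcpt : IsCompact (sliceMap '' (Metric.closedBall t (δ / 2) ×ˢ K)) :=
    ((isCompact_closedBall t (δ / 2)).prod hK).image sliceMap.continuous
  obtain ⟨C, hC⟩ := hcpt.exists_bound_of_continuousOn (f := pd 0 f) <| hc.mono <| by
    rintro _ ⟨q, hq, rfl⟩
    exact hI hq.1
  refine (hasDerivAt_integral_of_dominated_loc_of_deriv_le (𝕜 := ℝ)
    (F := fun s y => f (sliceMap (s, y))) (F' := fun s y => pd 0 f (sliceMap (s, y)))
    (bound := K.indicator fun _ => C)
    (Metric.closedBall_mem_nhds t (half_pos hδ)) ?_ (integrable_slice hK hf.continuousOn hs ht)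
    (continuous_slice hc ht).aestronglyMeasurable ?_ ?_ ?_).2
  · filter_upwards [hJ.mem_nhds ht] with s hs'
    exact (continuous_slice hf.continuousOn hs').aestronglyMeasurable
  · refine Eventually.of_forall fun y s hs' => ?_
    by_cases hy : y ∈ K
    · rw [indicator_of_mem hy]
      exact hC _ ⟨(s, y), ⟨hs', hy⟩, rfl⟩
    · rw [indicator_of_notMem hy, pd_eq_zero_of_notMem hJ hK hs 0 (hI hs') hy, norm_zero]
  · exact (integrable_indicator_iff hK.measurableSet).2
      (integrableOn_const hK.measure_lt_top.ne)
  · refine Eventually.of_forall fun y s hs' => ?_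
    have h1 : DifferentiableAt ℝ f (sliceMap (s, y)) :=
      ((hf.contDiffAt (hU.mem_nhds (hI hs')))).differentiableAt one_ne_zero
    have h2 : HasDerivAt (fun s : ℝ => sliceMap (s, y)) (sliceMap (1, 0)) s :=
      sliceMap.hasFDerivAt.comp_hasDerivAt s ((hasDerivAt_id s).prodMk (hasDerivAt_const s y))
    rw [sliceMap_time] at h2
    exact h1.hasFDerivAt.comp_hasDerivAt s h2

/-- Spatial derivatives of functions of spatially compact support integrate to zero. -/
lemma integral_pd_succ_eq_zero (hJ : IsOpen J) (hK : IsCompact K)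
    (hf : ContDiffOn ℝ 1 f {x | x 0 ∈ J})
    (hs : ∀ t ∈ J, ∀ y ∉ K, f (sliceMap (t, y)) = 0) {t : ℝ} (ht : t ∈ J) (i : Fin 3) :
    ∫ y : E3, pd i.succ f (sliceMap (t, y)) = 0 := by
  have hU := isOpen_timeSlab hJ
  have h1 : ∀ y : E3, HasFDerivAt (fun y : E3 => f (sliceMap (t, y)))
      (fderiv ℝ f (sliceMap (t, y)) ∘L (sliceMap ∘L ContinuousLinearMap.inr ℝ ℝ E3)) y := by
    intro y
    have h2 : DifferentiableAt ℝ f (sliceMap (t, y)) :=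
      ((hf.contDiffAt (hU.mem_nhds ht))).differentiableAt one_ne_zero
    exact h2.hasFDerivAt.comp y (sliceMap.hasFDerivAt.comp y (hasFDerivAt_prodMk_right t y))
  have h3 : ∀ y : E3, fderiv ℝ (fun y : E3 => f (sliceMap (t, y))) y (EuclideanSpace.single i 1)
      = pd i.succ f (sliceMap (t, y)) := by
    intro y
    rw [(h1 y).fderiv]
    change fderiv ℝ f (sliceMap (t, y)) (sliceMap (0, EuclideanSpace.single i 1)) = _
    rw [sliceMap_space]
    rfl
  have hi := integrable_slice hK (continuousOn_pd hU hf i.succ)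
    (fun t ht y hy => pd_eq_zero_of_notMem hJ hK hs i.succ ht hy) ht
  have h4 := integral_mul_fderiv_eq_neg_fderiv_mul_of_integrable (μ := (volume : Measure E3))
    (f := fun _ : E3 => (1 : ℂ)) (g := fun y : E3 => f (sliceMap (t, y)))
    (v := EuclideanSpace.single i 1) (by simp) (by simpa only [one_mul, h3] using hi)
    (by simpa only [one_mul] using integrable_slice hK hf.continuousOn hs ht)
    (fun _ _ => differentiableAt_const _) (fun y _ => (h1 y).differentiableAt)
  simpa [h3] using h4

/-- The integral form of a conservation law: the rate of change of the integral of the density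
`W 0` of a current `W` of spatially compact support is the integral of the divergence of `W`. -/
theorem hasDerivAt_integral_divergence {W : Fin 4 → (Fin 4 → ℝ) → ℂ} (hJ : IsOpen J)
    (hK : IsCompact K) (hW : ∀ μ, ContDiffOn ℝ 1 (W μ) {x | x 0 ∈ J})
    (hs : ∀ μ, ∀ t ∈ J, ∀ y ∉ K, W μ (sliceMap (t, y)) = 0) {t : ℝ} (ht : t ∈ J) :
    HasDerivAt (fun s => ∫ y : E3, W 0 (sliceMap (s, y)))
      (∫ y : E3, ∑ μ, pd μ (W μ) (sliceMap (t, y))) t := by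
  have hU := isOpen_timeSlab hJ
  rw [integral_finsetSum _ fun μ _ => integrable_slice hK (continuousOn_pd hU (hW μ) μ)
    (fun t ht y hy => pd_eq_zero_of_notMem hJ hK (hs μ) μ ht hy) ht, Fin.sum_univ_succ]
  simp only [integral_pd_succ_eq_zero hJ hK (hW _) (hs _) ht, Finset.sum_const_zero, add_zero]
  exact hasDerivAt_integral_slice hJ hK (hW 0) (hs 0) ht

end Slices

/-! ### Tetrads in the coordinates of a chart -/

section Charts

variable {S : Type*} [TopologicalSpace S]
  {c : OpenPartialHomeomorph S E3} {J : Set ℝ}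

lemma isOpen_coordDomain (hJ : IsOpen J) : IsOpen (coordDomain J c) :=
  (isOpen_timeSlab hJ).inter (c.open_target.preimage continuous_toLp_tail)

lemma point_mem {x : Fin 4 → ℝ} (hx : x ∈ coordDomain J c) : point c x ∈ J ×ˢ c.source :=
  ⟨hx.1, c.map_target hx.2⟩

lemma coord_point {x : Fin 4 → ℝ} (hx : x ∈ coordDomain J c) :
    (fun μ => coord c μ (point c x)) = x := by
  ext μ
  refine Fin.cases rfl (fun i => ?_) μ
  change c (c.symm (WithLp.toLp 2 (Fin.tail x))) i = _
  rw [c.right_inv hx.2]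
  rfl

lemma point_coord {q : ℝ × S} (hq : q.2 ∈ c.source) : point c (fun μ => coord c μ q) = q := by
  refine Prod.ext rfl ?_
  exact c.left_inv hq

lemma coord_mem {q : ℝ × S} (hq : q ∈ J ×ˢ c.source) :
    (fun μ => coord c μ q) ∈ coordDomain J c :=
  ⟨hq.1, c.map_source hq.2⟩

variable [ChartedSpace E3 S] [IsManifold (𝓡 3) ∞ S]

lemma contMDiffOn_coord (hc : c ∈ atlas E3 S) (μ : Fin 4) :
    ContMDiffOn I4 𝓘(ℝ, ℝ) ∞ (coord c μ) (univ ×ˢ c.source) := by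
  refine Fin.cases ?_ (fun i => ?_) μ
  · exact contMDiff_fst.contMDiffOn
  · have h1 : ContMDiffOn (𝓡 3) (𝓡 3) ∞ c c.source :=
      contMDiffOn_of_mem_maximalAtlas (IsManifold.subset_maximalAtlas hc)
    have h2 : ContMDiffOn I4 (𝓡 3) ∞ (fun q : ℝ × S => c q.2) (univ ×ˢ c.source) :=
      h1.comp contMDiff_snd.contMDiffOn fun q hq => hq.2
    exact (EuclideanSpace.proj i : E3 →L[ℝ] ℝ).contMDiff.comp_contMDiffOn h2

lemma contMDiffOn_point (hc : c ∈ atlas E3 S) :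
    ContMDiffOn 𝓘(ℝ, Fin 4 → ℝ) I4 ∞ (point c) (coordDomain univ c) := by
  have h1 : ContMDiffOn (𝓡 3) (𝓡 3) ∞ c.symm c.target :=
      contMDiffOn_symm_of_mem_maximalAtlas (IsManifold.subset_maximalAtlas hc)
  refine ContMDiffOn.prodMk ?_ (h1.comp (t := c.target) ?_ fun x hx => hx.2)
  · exact (ContinuousLinearMap.proj 0 : (Fin 4 → ℝ) →L[ℝ] ℝ).contMDiff.contMDiffOn
  · have h2 : ContDiff ℝ ∞ fun x : Fin 4 → ℝ => (WithLp.toLp 2 (Fin.tail x) : E3) :=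
      contDiff_euclidean.2 fun i => contDiff_apply ℝ ℝ i.succ
    exact h2.contMDiff.contMDiffOn

lemma differentiableAt_transition {d : OpenPartialHomeomorph S E3} (hc : c ∈ atlas E3 S)
    (hd : d ∈ atlas E3 S) {y : E3} (hy : y ∈ c.target) (hyd : c.symm y ∈ d.source) :
    DifferentiableAt ℝ (fun z => d (c.symm z)) y := by
  have h1 : ContMDiffAt (𝓡 3) (𝓡 3) ∞ (fun z => d (c.symm z)) y :=
    ((contMDiffOn_of_mem_maximalAtlas (IsManifold.subset_maximalAtlas hd)).contMDiffAt
      (d.open_source.mem_nhds hyd)).comp y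
    ((contMDiffOn_symm_of_mem_maximalAtlas (IsManifold.subset_maximalAtlas hc)).contMDiffAt
      (c.open_target.mem_nhds hy))
  exact h1.contDiffAt.differentiableAt (by simp)

variable {e : Fin 4 → (q : ℝ × S) → TangentSpace I4 q}

lemma hasMFDerivAt_coords (hc : c ∈ atlas E3 S) {q : ℝ × S} (hq : q.2 ∈ c.source) :
    HasMFDerivAt I4 𝓘(ℝ, Fin 4 → ℝ) (fun q μ => coord c μ q) q
      (ContinuousLinearMap.pi fun μ => (mfderiv I4 𝓘(ℝ, ℝ) (coord c μ) q :
        TangentSpace I4 q →L[ℝ] ℝ)) := by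
  have hU : (univ ×ˢ c.source : Set (ℝ × S)) ∈ 𝓝 q :=
    (isOpen_univ.prod c.open_source).mem_nhds ⟨mem_univ _, hq⟩
  have h1 : ∀ μ, HasMFDerivAt I4 𝓘(ℝ, ℝ) (coord c μ) q (mfderiv I4 𝓘(ℝ, ℝ) (coord c μ) q) :=
    fun μ => (((contMDiffOn_coord hc μ).contMDiffAt hU).mdifferentiableAt (by simp)).hasMFDerivAt
  refine ⟨continuousAt_pi.2 fun μ => (h1 μ).1, ?_⟩
  exact hasFDerivWithinAt_pi.2 fun μ => (h1 μ).2

lemma mdifferentiableAt_point (hc : c ∈ atlas E3 S) {x : Fin 4 → ℝ}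
    (hx : x ∈ coordDomain univ c) : MDifferentiableAt 𝓘(ℝ, Fin 4 → ℝ) I4 (point c) x :=
  ((contMDiffOn_point hc).contMDiffAt
    ((isOpen_coordDomain isOpen_univ).mem_nhds hx)).mdifferentiableAt (by simp)

/-- The chain rule `e_A(f) = e_A^μ ∂_μ f`. -/
lemma frameDeriv_eq_sum (hc : c ∈ atlas E3 S) (A : Fin 4) {f : ℝ × S → ℝ} {q : ℝ × S}
    (hq : q.2 ∈ c.source) (hf : MDifferentiableAt I4 𝓘(ℝ, ℝ) f q) :
    frameDeriv e A f q = ∑ μ, frameDeriv e A (coord c μ) q *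
      pd μ (fun x => f (point c x)) (fun μ => coord c μ q) := by
  set x : Fin 4 → ℝ := fun μ => coord c μ q
  have hxm : x ∈ coordDomain univ c := coord_mem (J := univ) ⟨mem_univ _, hq⟩
  have hpx : point c x = q := point_coord hq
  have hU : (univ ×ˢ c.source : Set (ℝ × S)) ∈ 𝓝 q :=
    (isOpen_univ.prod c.open_source).mem_nhds ⟨mem_univ _, hq⟩
  have h2 := hasMFDerivAt_coords hc hq
  have h3 : MDifferentiableAt 𝓘(ℝ, Fin 4 → ℝ) 𝓘(ℝ, ℝ) (fun x => f (point c x)) x := by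
    refine MDifferentiableAt.comp (I' := I4) x (by rw [hpx]; exact hf) ?_
    exact mdifferentiableAt_point hc hxm
  have h4 : f =ᶠ[𝓝 q] (fun x => f (point c x)) ∘ fun q μ => coord c μ q := by
    filter_upwards [hU] with p hp
    simp [point_coord hp.2]
  have h5 := (h3.hasMFDerivAt.comp q h2).congr_of_eventuallyEq h4
  rw [frameDeriv, h5.mfderiv]
  have h6 : ∀ v : Fin 4 → ℝ, fderiv ℝ (fun x => f (point c x)) x v
      = ∑ μ, v μ * pd μ (fun x => f (point c x)) x := by
    intro v
    conv_lhs => rw [pi_eq_sum_univ' v]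
    simp only [map_sum, map_smul, smul_eq_mul, pd]
  change mfderiv 𝓘(ℝ, Fin 4 → ℝ) 𝓘(ℝ, ℝ) (fun x => f (point c x)) x _ = _
  rw [mfderiv_eq_fderiv]
  exact h6 _

/-- Differentiation along a tetrad vector costs one derivative. -/
lemma IsTetrad.contMDiffOn_frameDeriv (he : IsTetrad J e) (A : Fin 4) {n : ℕ∞ω} (hn : n ≤ 1)
    {f : ℝ × S → ℝ} {U : Set S} (hU : IsOpen U)
    (hf : ContMDiffOn I4 𝓘(ℝ, ℝ) (n + 1) f (univ ×ˢ U)) :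
    ContMDiffOn I4 𝓘(ℝ, ℝ) n (frameDeriv e A f) (J ×ˢ U) := by
  have hV : IsOpen (univ ×ˢ U : Set (ℝ × S)) := isOpen_univ.prod hU
  have h1 := hf.contMDiffOn_tangentMapWithin le_rfl hV.uniqueMDiffOn
  have h2 := h1.comp (((he.contMDiffOn A).mono (prod_mono_right (subset_univ U))).of_le hn)
    (fun q hq => ⟨mem_univ _, hq.2⟩)
  have h3 := (contMDiff_snd_tangentBundle_modelSpace ℝ 𝓘(ℝ, ℝ) (n := n)).comp_contMDiffOn h2
  refine h3.congr fun q hq => ?_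
  change mfderiv I4 𝓘(ℝ, ℝ) f q (e A q) = mfderivWithin I4 𝓘(ℝ, ℝ) f (univ ×ˢ U) q (e A q)
  rw [mfderivWithin_of_isOpen hV ⟨mem_univ _, hq.2⟩]

lemma IsTetrad.contMDiffOn_frameDeriv_coord (he : IsTetrad J e) (hc : c ∈ atlas E3 S)
    (A μ : Fin 4) : ContMDiffOn I4 𝓘(ℝ, ℝ) 1 (frameDeriv e A (coord c μ)) (J ×ˢ c.source) :=
  he.contMDiffOn_frameDeriv A le_rfl c.open_source
    ((contMDiffOn_coord hc μ).of_le (by norm_cast))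

lemma contDiffOn_comp_point {F : Type*} [NormedAddCommGroup F] [NormedSpace ℝ F] {n : ℕ∞ω}
    (hn : n ≤ ∞) (hc : c ∈ atlas E3 S) {f : ℝ × S → F}
    (hf : ContMDiffOn I4 𝓘(ℝ, F) n f (J ×ˢ c.source)) :
    ContDiffOn ℝ n (fun x => f (point c x)) (coordDomain J c) := by
  rw [← contMDiffOn_iff_contDiffOn]
  exact hf.comp (((contMDiffOn_point hc).of_le hn).mono fun x hx => ⟨mem_univ _, hx.2⟩)
    fun x hx => point_mem hx

lemma IsTetrad.contDiffOn_frameInChart (he : IsTetrad J e) (hc : c ∈ atlas E3 S) (A μ : Fin 4) :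
    ContDiffOn ℝ 1 (fun x => frameInChart e c x A μ) (coordDomain J c) :=
  contDiffOn_comp_point (by simp) hc (he.contMDiffOn_frameDeriv_coord hc A μ)

lemma IsTetrad.diffEntries_frameInChart (he : IsTetrad J e) (hJ : IsOpen J)
    (hc : c ∈ atlas E3 S) {x : Fin 4 → ℝ} (hx : x ∈ coordDomain J c) :
    DiffEntries (frameInChart e c) x := fun A μ =>
  ((he.contDiffOn_frameInChart hc A μ).contDiffAt
    ((isOpen_coordDomain hJ).mem_nhds hx)).differentiableAt one_ne_zero

/-- The components of a tetrad form an invertible matrix: the differential of the coordinates is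
injective, having the differential of `point c` as a left inverse. -/
lemma IsTetrad.det_frameInChart_ne_zero (he : IsTetrad J e) (hc : c ∈ atlas E3 S)
    {x : Fin 4 → ℝ} (hx : x ∈ coordDomain J c) : (frameInChart e c x).det ≠ 0 := by
  have hq := (point_mem hx).2
  set q := point c x
  have hxm : x ∈ coordDomain univ c := ⟨mem_univ _, hx.2⟩
  set T : TangentSpace I4 q →L[ℝ] (Fin 4 → ℝ) :=
    ContinuousLinearMap.pi fun μ => (mfderiv I4 𝓘(ℝ, ℝ) (coord c μ) q :
        TangentSpace I4 q →L[ℝ] ℝ)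
  have h1 : HasMFDerivAt I4 𝓘(ℝ, Fin 4 → ℝ) (fun q μ => coord c μ q) q T :=
    hasMFDerivAt_coords hc hq
  have hcx : (fun μ => coord c μ q) = x := coord_point hx
  have h2 : MDifferentiableAt 𝓘(ℝ, Fin 4 → ℝ) I4 (point c) (fun μ => coord c μ q) := by
    rw [hcx]
    exact mdifferentiableAt_point hc hxm
  have h3 := h2.hasMFDerivAt.comp q h1
  have h4 : HasMFDerivAt I4 I4 (point c ∘ fun q μ => coord c μ q) q
      (ContinuousLinearMap.id ℝ (TangentSpace I4 q)) := by
    refine (hasMFDerivAt_id q).congr_of_eventuallyEq ?_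
    filter_upwards [(isOpen_univ.prod c.open_source).mem_nhds
      (⟨mem_univ _, hq⟩ : q ∈ univ ×ˢ c.source)] with p hp
    exact point_coord hp.2
  have h5 := hasMFDerivAt_unique h3 h4
  have hinj : Function.Injective T := by
    intro v w hvw
    have hv := congrArg (fun L => L v) h5
    have hw := congrArg (fun L => L w) h5
    have hvw' : (mfderiv 𝓘(ℝ, Fin 4 → ℝ) I4 (point c) fun μ => coord c μ q) (T v)
      = (mfderiv 𝓘(ℝ, Fin 4 → ℝ) I4 (point c) fun μ => coord c μ q) (T w) := by rw [hvw]
    exact hv.symm.trans (hvw'.trans hw)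
  have hker : LinearMap.ker T.toLinearMap = ⊥ := LinearMap.ker_eq_bot_of_injective hinj
  have h6 := (he.linearIndependent q ⟨hx.1, mem_univ _⟩).map' T.toLinearMap hker
  have h7 : LinearIndependent ℝ (frameInChart e c x).row := h6
  rw [Matrix.linearIndependent_rows_iff_isUnit, Matrix.isUnit_iff_isUnit_det] at h7
  exact h7.ne_zero

lemma IsTetrad.contDiffOn_sqrtNegDet (he : IsTetrad J e) {σ : ℝ} (hσ : σ = 1 ∨ σ = -1)
    (hc : c ∈ atlas E3 S) :
    ContDiffOn ℝ 1 (sqrtNegDet σ (frameInChart e c)) (coordDomain J c) := by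
  have h1 : ContDiffOn ℝ 1 (fun x => (frameInChart e c x).det) (coordDomain J c) := by
    simp only [Matrix.det_apply, Units.smul_def, zsmul_eq_mul]
    exact ContDiffOn.sum fun s _ => contDiffOn_const.mul <|
      contDiffOn_prod fun i _ => he.contDiffOn_frameInChart hc _ _
  rw [funext (sqrtNegDet_eq hσ (frameInChart e c))]
  refine ContDiffOn.inv (fun x hx => ?_)
    fun x hx => abs_ne_zero.2 (he.det_frameInChart_ne_zero hc hx)
  exact (h1 x hx).abs (he.det_frameInChart_ne_zero hc hx)

/-- The volume factor transforms as a density under a change of coordinates on `S`. -/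
lemma IsTetrad.sqrtNegDet_transition (he : IsTetrad J e) {σ : ℝ} (hσ : σ = 1 ∨ σ = -1)
    {d : OpenPartialHomeomorph S E3} (hc : c ∈ atlas E3 S) (hd : d ∈ atlas E3 S) {t : ℝ}
    (ht : t ∈ J) {y : E3} (hy : y ∈ c.target) (hyd : c.symm y ∈ d.source) :
    sqrtNegDet σ (frameInChart e c) (sliceMap (t, y))
      = |(fderiv ℝ (fun z => d (c.symm z)) y).det|
        * sqrtNegDet σ (frameInChart e d) (sliceMap (t, d (c.symm y))) := by
  set x := sliceMap (t, y)
  set τ : E3 → E3 := fun z => d (c.symm z)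
  have hxc : x ∈ coordDomain J c := ⟨ht, hy⟩
  set x' := sliceMap (t, τ y)
  have hxd : x' ∈ coordDomain J d := ⟨ht, d.map_source hyd⟩
  have hp : point d x' = point c x := Prod.ext rfl (d.left_inv hyd)
  have hcx : (fun μ => coord c μ (point c x)) = x := coord_point hxc
  have hmd : ∀ μ, MDifferentiableAt I4 𝓘(ℝ, ℝ) (coord d μ) (point c x) := fun μ =>
    ((contMDiffOn_coord hd μ).contMDiffAt ((isOpen_univ.prod d.open_source).mem_nhds
      ⟨mem_univ _, hyd⟩)).mdifferentiableAt (by simp)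
  set Q : Matrix (Fin 4) (Fin 4) ℝ :=
    Matrix.of fun ν μ => pd ν (fun z => coord d μ (point c z)) x with hQ
  have h1 : frameInChart e d x' = frameInChart e c x * Q := by
    ext A μ
    rw [Matrix.mul_apply]
    simp only [frameInChart, Matrix.of_apply, hp, hQ]
    rw [frameDeriv_eq_sum hc A (point_mem hxc).2 (hmd μ), hcx]
  have hτd : DifferentiableAt ℝ τ y := differentiableAt_transition hc hd hy hyd
  -- the spacetime Jacobian is block diagonal, with blocks `1` and the Jacobian of `τ`
  have h0 : ∀ ν, Q ν 0 = (Pi.single ν 1 : Fin 4 → ℝ) 0 := by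
    intro ν
    change fderiv ℝ (ContinuousLinearMap.proj (R := ℝ) (φ := fun _ : Fin 4 => ℝ) 0) x _ = _
    rw [ContinuousLinearMap.fderiv]
    rfl
  have hs : ∀ ν (k : Fin 3), Q ν k.succ
      = fderiv ℝ τ y (WithLp.toLp 2 (Fin.tail (Pi.single ν 1 : Fin 4 → ℝ))) k := by
    intro ν k
    let P : (Fin 4 → ℝ) →L[ℝ] E3 := ((EuclideanSpace.equiv (Fin 3) ℝ).symm : (Fin 3 → ℝ) →L[ℝ] E3)
      ∘L ContinuousLinearMap.pi fun i => ContinuousLinearMap.proj i.succ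
    have hτP : HasFDerivAt τ (fderiv ℝ τ y) (P x) := hτd.hasFDerivAt
    have hP : HasFDerivAt (fun z : Fin 4 → ℝ => τ (P z)) (fderiv ℝ τ y ∘L P) x :=
      hτP.comp x P.hasFDerivAt
    have h4 := ((EuclideanSpace.proj k : E3 →L[ℝ] ℝ).hasFDerivAt.comp x hP).fderiv
    change fderiv ℝ (fun z => (EuclideanSpace.proj k : E3 →L[ℝ] ℝ) (τ (P z))) x _ = _
    exact congrArg (fun L => L (Pi.single ν 1)) h4
  have hdet : Q.det = (fderiv ℝ τ y).det := by
    rw [Matrix.det_succ_column_zero, Fin.sum_univ_succ]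
    simp only [h0, Pi.single_apply, if_true, Fin.val_zero, pow_zero, one_mul,
      (Fin.succ_ne_zero _).symm, if_false, mul_zero, zero_mul, Finset.sum_const_zero, add_zero]
    rw [ContinuousLinearMap.det, ← LinearMap.det_toMatrix
      (EuclideanSpace.basisFun (Fin 3) ℝ).toBasis, ← Matrix.det_transpose]
    congr 1
    ext k j
    simp only [Matrix.transpose_apply, Matrix.submatrix_apply, Fin.succAbove_zero, hs,
      LinearMap.toMatrix_apply]
    rw [← sliceMap_space, toLp_tail_sliceMap]
    simp
  have hQ0 : Q.det ≠ 0 := by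
    have := he.det_frameInChart_ne_zero hd hxd
    rw [h1, Matrix.det_mul] at this
    exact right_ne_zero_of_mul this
  rw [sqrtNegDet_eq hσ, sqrtNegDet_eq hσ, h1, Matrix.det_mul, ← hdet, abs_mul, mul_inv]
  field_simp [abs_ne_zero.2 hQ0]

end Charts

/-! ### The measure on the slices -/

section SliceMeasure

/-- The preimage of a measurable set under a chart inverse is measurable in the target. -/
lemma measurableSet_target_inter_preimage {S : Type*} [TopologicalSpace S] [MeasurableSpace S]
    [BorelSpace S] (c : OpenPartialHomeomorph S E3) {A : Set S} (hA : MeasurableSet A) :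
    MeasurableSet (c.target ∩ c.symm ⁻¹' A) := by
  have h1 : Measurable (c.target.domRestrict c.symm) :=
    (continuousOn_iff_continuous_domRestrict.1 c.continuousOn_symm).measurable
  have h2 := c.open_target.measurableSet.subtype_image (h1 hA)
  rwa [show c.target.domRestrict c.symm ⁻¹' A = ((↑) : c.target → E3) ⁻¹' (c.symm ⁻¹' A) from rfl,
    Subtype.image_preimage_coe] at h2

variable {S : Type*} [TopologicalSpace S] {c d : OpenPartialHomeomorph S E3}

lemma aemeasurable_chart_symm [MeasurableSpace S] [BorelSpace S] {f : E3 → ENNReal} :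
    AEMeasurable c.symm ((volume.restrict c.target).withDensity f) :=
  (c.continuousOn_symm.aemeasurable c.open_target.measurableSet).mono_ac
    (withDensity_absolutelyContinuous _ _)

variable [ChartedSpace E3 S] {J : Set ℝ} {σ : ℝ} {e : Fin 4 → (q : ℝ × S) → TangentSpace I4 q}
  {t : ℝ}

/-- The volume density `√(-g)` on the slice of time `t` in the chart `c`. -/
noncomputable def sliceDensity (σ : ℝ) (e : Fin 4 → (q : ℝ × S) → TangentSpace I4 q)
    (c : OpenPartialHomeomorph S E3) (t : ℝ) (y : E3) : ℝ :=
  sqrtNegDet σ (frameInChart e c) (sliceMap (t, y))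

lemma sliceDensity_nonneg (y : E3) : 0 ≤ sliceDensity σ e c t y := Real.sqrt_nonneg _

lemma IsTetrad.continuousOn_sliceDensity [IsManifold (𝓡 3) ∞ S] (he : IsTetrad J e)
    (hσ : σ = 1 ∨ σ = -1) (hc : c ∈ atlas E3 S) (ht : t ∈ J) :
    ContinuousOn (sliceDensity σ e c t) c.target :=
  (he.contDiffOn_sqrtNegDet hσ hc).continuousOn.comp
    ((sliceMap.continuous.comp (Continuous.prodMk_right t)).continuousOn) fun _ hy => ⟨ht, hy⟩

variable [MeasurableSpace S]

/-- The measure `√(-g) d³x` on the part of the slice of time `t` that a chart covers. -/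
noncomputable def chartMeasure (σ : ℝ) (e : Fin 4 → (q : ℝ × S) → TangentSpace I4 q)
    (c : OpenPartialHomeomorph S E3) (t : ℝ) : Measure S :=
  Measure.map c.symm ((volume.restrict c.target).withDensity fun y : E3 =>
    ENNReal.ofReal (sliceDensity σ e c t y))

lemma sliceMeasure_eq_iSup :
    sliceMeasure σ e t = ⨆ c ∈ atlas E3 S, chartMeasure σ e c t := by
  simp only [sliceMeasure, chartMeasure, sliceDensity, sliceMap_eq]

variable [BorelSpace S]

lemma chartMeasure_apply {A : Set S} (hA : MeasurableSet A) :
    chartMeasure σ e c t A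
      = ∫⁻ y in c.target ∩ c.symm ⁻¹' A, ENNReal.ofReal (sliceDensity σ e c t y) := by
  rw [chartMeasure, Measure.map_apply_of_aemeasurable aemeasurable_chart_symm hA,
    withDensity_apply' _ _, Measure.restrict_restrict' c.open_target.measurableSet, inter_comm]

variable [IsManifold (𝓡 3) ∞ S]

/-- The measures that two charts define agree on the overlap of their domains. -/
lemma IsTetrad.restrict_chartMeasure_le (he : IsTetrad J e) (hσ : σ = 1 ∨ σ = -1)
    (hc : c ∈ atlas E3 S) (hd : d ∈ atlas E3 S) (ht : t ∈ J) :
    (chartMeasure σ e d t).restrict c.source ≤ chartMeasure σ e c t := by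
  refine Measure.le_iff.2 fun A hA => ?_
  have hS := c.open_source.measurableSet
  rw [Measure.restrict_apply hA, chartMeasure_apply (hA.inter hS), chartMeasure_apply hA]
  set τ : E3 → E3 := fun z => d (c.symm z) with hτ
  set B := c.target ∩ c.symm ⁻¹' (A ∩ d.source)
  have hBm : MeasurableSet B :=
    measurableSet_target_inter_preimage c (hA.inter d.open_source.measurableSet)
  have himage : d.target ∩ d.symm ⁻¹' (A ∩ c.source) = τ '' B := by
    ext z
    constructor
    · rintro ⟨hz, hzA, hzc⟩
      refine ⟨c (d.symm z), ⟨c.map_source hzc, ?_⟩, ?_⟩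
      · rw [mem_preimage, c.left_inv hzc]
        exact ⟨hzA, d.map_target hz⟩
      · rw [hτ]
        simp only
        rw [c.left_inv hzc, d.right_inv hz]
    · rintro ⟨y, ⟨hy, hyA, hyd⟩, rfl⟩
      refine ⟨d.map_source hyd, ?_⟩
      rw [mem_preimage, hτ, d.left_inv hyd]
      exact ⟨hyA, c.map_target hy⟩
  have hinj : InjOn τ B := by
    intro y hy z hz hyz
    exact c.symm.injOn hy.1 hz.1 (d.injOn hy.2.2 hz.2.2 hyz)
  have hderiv : ∀ y ∈ B, HasFDerivWithinAt τ (fderiv ℝ τ y) B y := fun y hy =>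
    (differentiableAt_transition hc hd hy.1 hy.2.2).hasFDerivAt.hasFDerivWithinAt
  rw [himage, lintegral_image_eq_lintegral_abs_det_fderiv_mul volume hBm hderiv hinj]
  calc _ = ∫⁻ y in B, ENNReal.ofReal (sliceDensity σ e c t y) := by
        refine setLIntegral_congr_fun hBm fun y hy => ?_
        rw [← ENNReal.ofReal_mul (abs_nonneg _), sliceDensity, sliceDensity,
          he.sqrtNegDet_transition hσ hc hd ht hy.1 hy.2.2]
    _ ≤ _ := lintegral_mono_set (inter_subset_inter_right _ (preimage_mono inter_subset_left))

/-- On the domain of a chart the slice measure is `√(-g) d³x`. -/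
theorem IsTetrad.restrict_sliceMeasure (he : IsTetrad J e) (hσ : σ = 1 ∨ σ = -1)
    (hc : c ∈ atlas E3 S) (ht : t ∈ J) :
    (sliceMeasure σ e t).restrict c.source = chartMeasure σ e c t := by
  have hS := c.open_source.measurableSet
  have h0 : chartMeasure σ e c t c.sourceᶜ = 0 := by
    rw [chartMeasure_apply hS.compl]
    rw [show c.target ∩ c.symm ⁻¹' c.sourceᶜ = ∅ from
      eq_empty_of_forall_notMem fun y hy => hy.2 (c.map_target hy.1)]
    simp
  refine le_antisymm ?_ ?_
  -- off the domain of the chart the measure `⊤` dominates those of all charts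
  · have h1 : sliceMeasure σ e t
        ≤ chartMeasure σ e c t + (⊤ : Measure S).restrict c.sourceᶜ := by
      rw [sliceMeasure_eq_iSup]
      refine iSup₂_le fun d hd => ?_
      rw [← Measure.restrict_add_restrict_compl (μ := chartMeasure σ e d t) hS]
      exact add_le_add (he.restrict_chartMeasure_le hσ hc hd ht)
        (Measure.restrict_mono le_rfl le_top)
    refine (Measure.restrict_mono le_rfl h1).trans ?_
    rw [Measure.restrict_add, Measure.restrict_restrict hS, inter_compl_self,
      Measure.restrict_empty, add_zero]
    exact Measure.restrict_le_self
  · rw [← Measure.restrict_add_restrict_compl (μ := chartMeasure σ e c t) hS,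
      Measure.restrict_eq_zero.2 h0, add_zero, sliceMeasure_eq_iSup]
    exact Measure.restrict_mono le_rfl (le_iSup₂_of_le c hc le_rfl)

/-- Integrals of functions supported in the domain of a chart, computed in the chart. -/
theorem IsTetrad.integral_sliceMeasure (he : IsTetrad J e) (hσ : σ = 1 ∨ σ = -1)
    (hc : c ∈ atlas E3 S) (ht : t ∈ J) {g : S → ℂ} (hg : Continuous g)
    (hs : ∀ p ∉ c.source, g p = 0) :
    (Integrable g (sliceMeasure σ e t) ↔
      IntegrableOn (fun y => (sliceDensity σ e c t y : ℂ) * g (c.symm y)) c.target) ∧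
    ∫ p, g p ∂(sliceMeasure σ e t)
      = ∫ y in c.target, (sliceDensity σ e c t y : ℂ) * g (c.symm y) := by
  have hT := c.open_target.measurableSet
  have hsub : Function.support g ⊆ c.source := fun p hp => by
    by_contra h
    exact hp (hs p h)
  have hm : AEMeasurable (fun y => ENNReal.ofReal (sliceDensity σ e c t y))
      (volume.restrict c.target) :=
    ((he.continuousOn_sliceDensity hσ hc ht).aemeasurable hT).ennreal_ofReal
  have hlt : ∀ᵐ y ∂(volume.restrict c.target), ENNReal.ofReal (sliceDensity σ e c t y) < ⊤ :=
    Eventually.of_forall fun _ => ENNReal.ofReal_lt_top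
  have hr : ∀ y, (ENNReal.ofReal (sliceDensity σ e c t y)).toReal • g (c.symm y)
      = (sliceDensity σ e c t y : ℂ) * g (c.symm y) := fun y => by
    rw [ENNReal.toReal_ofReal (sliceDensity_nonneg y), Complex.real_smul]
  constructor
  · rw [← integrableOn_iff_integrable_of_support_subset hsub, IntegrableOn,
      he.restrict_sliceMeasure hσ hc ht, chartMeasure,
      integrable_map_measure hg.aestronglyMeasurable aemeasurable_chart_symm,
      integrable_withDensity_iff_integrable_smul₀' hm hlt, IntegrableOn]
    simp only [Function.comp_apply, hr]
  · rw [← setIntegral_eq_integral_of_forall_compl_eq_zero hs, he.restrict_sliceMeasure hσ hc ht,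
      chartMeasure, integral_map aemeasurable_chart_symm hg.aestronglyMeasurable,
      integral_withDensity_eq_integral_toReal_smul₀ hm hlt]
    simp only [hr]

end SliceMeasure

/-! ### The current on spacetime -/

section SpacetimeCurrent

variable {S : Type*} [TopologicalSpace S] [ChartedSpace E3 S]
  {c : OpenPartialHomeomorph S E3} {J : Set ℝ} {ε σ m : ℝ}
  {γ : Fin 4 → Matrix (Fin 4) (Fin 4) ℂ}
  {e : Fin 4 → (q : ℝ × S) → TangentSpace I4 q} {φ ψ : ℝ × S → Spinor}

lemma currentAlong_eq_sum (f : ℝ × S → ℝ) (q : ℝ × S) :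
    currentAlong γ e φ ψ f q
      = ∑ A, frameDeriv e A f q • (diracAdjoint γ (φ q) ⬝ᵥ (γ A *ᵥ ψ q)) := by
  simp only [currentAlong, Matrix.sum_mulVec, dotProduct_sum, Matrix.smul_mulVec, dotProduct_smul,
    smul_eq_mul, Complex.real_smul]

lemma frameDeriv_congr {A : Fin 4} {f g : ℝ × S → ℝ} {q : ℝ × S} (h : f =ᶠ[𝓝 q] g) :
    frameDeriv e A f q = frameDeriv e A g q := by
  rw [frameDeriv, frameDeriv, h.mfderiv_eq]
  rfl

lemma frameDeriv_const {A : Fin 4} (a : ℝ) (q : ℝ × S) :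
    frameDeriv e A (fun _ => a) q = 0 := by
  rw [frameDeriv, mfderiv_const]
  rfl

/-- The current along a function of the position alone vanishes off the support of the function. -/
lemma currentAlong_eq_zero_of_notMem_tsupport {h : S → ℝ} {t : ℝ} {p : S} (hp : p ∉ tsupport h) :
    currentAlong γ e φ ψ (fun q => h q.2) (t, p) = 0 := by
  have h1 : (fun q : ℝ × S => h q.2) =ᶠ[𝓝 (t, p)] fun _ => 0 :=
    (continuous_snd.tendsto (t, p)).eventually (notMem_tsupport_iff_eventuallyEq.1 hp)
  rw [currentAlong_eq_sum]
  simp only [frameDeriv_congr h1, frameDeriv_const, zero_smul, Finset.sum_const_zero]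

lemma contDiff_diracBilinear (A : Fin 4) {n : ℕ∞ω} :
    ContDiff ℝ n fun w : Spinor × Spinor => diracAdjoint γ w.1 ⬝ᵥ (γ A *ᵥ w.2) := by
  have h1 : ∀ i, ContDiff ℝ n fun w : Spinor × Spinor => w.1 i := fun i =>
    (contDiff_apply ℝ ℂ i).comp contDiff_fst
  have h2 : ∀ i, ContDiff ℝ n fun w : Spinor × Spinor => w.2 i := fun i =>
    (contDiff_apply ℝ ℂ i).comp contDiff_snd
  have h3 : ∀ i, ContDiff ℝ n fun w : Spinor × Spinor => star (w.1 i) := fun i =>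
    ((starL' ℝ : ℂ ≃L[ℝ] ℂ).contDiff).comp (h1 i)
  simp only [dotProduct, diracAdjoint_apply, Matrix.mulVec]
  exact ContDiff.sum fun i _ => (ContDiff.sum fun j _ => (h3 j).mul contDiff_const).mul
    (ContDiff.sum fun j _ => contDiff_const.mul (h2 j))

lemma contMDiffOn_comp_prod {F₁ F₂ F₃ : Type*} [NormedAddCommGroup F₁] [NormedSpace ℝ F₁]
    [NormedAddCommGroup F₂] [NormedSpace ℝ F₂] [NormedAddCommGroup F₃] [NormedSpace ℝ F₃]
    {n : ℕ∞ω} {g : F₁ × F₂ → F₃} (hg : ContDiff ℝ n g) {u : ℝ × S → F₁} {v : ℝ × S → F₂}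
    {U : Set (ℝ × S)} (hu : ContMDiffOn I4 𝓘(ℝ, F₁) n u U)
    (hv : ContMDiffOn I4 𝓘(ℝ, F₂) n v U) :
    ContMDiffOn I4 𝓘(ℝ, F₃) n (fun q => g (u q, v q)) U :=
  hg.contMDiff.comp_contMDiffOn (hu.prodMk_space hv)

/-- The current along `f` is as smooth as the derivatives of `f` along the tetrad, up to `C¹`. -/
lemma contMDiffOn_currentAlong (hφ : ContMDiffOn I4 𝓘(ℝ, Spinor) 1 φ (J ×ˢ univ))
    (hψ : ContMDiffOn I4 𝓘(ℝ, Spinor) 1 ψ (J ×ˢ univ)) {n : ℕ∞ω} (hn : n ≤ 1)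
    {f : ℝ × S → ℝ} {U : Set S}
    (hf : ∀ A, ContMDiffOn I4 𝓘(ℝ, ℝ) n (frameDeriv e A f) (J ×ˢ U)) :
    ContMDiffOn I4 𝓘(ℝ, ℂ) n (currentAlong γ e φ ψ f) (J ×ˢ U) := by
  have hsub : J ×ˢ U ⊆ J ×ˢ (univ : Set S) := prod_mono_right (subset_univ U)
  have h1 : ∀ A, ContMDiffOn I4 𝓘(ℝ, ℂ) n
      (fun q => diracAdjoint γ (φ q) ⬝ᵥ (γ A *ᵥ ψ q)) (J ×ˢ U) := fun A =>
    contMDiffOn_comp_prod (contDiff_diracBilinear A) ((hφ.mono hsub).of_le hn)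
      ((hψ.mono hsub).of_le hn)
  have h2 : ∀ A, ContMDiffOn I4 𝓘(ℝ, ℂ) n
      (fun q => frameDeriv e A f q • (diracAdjoint γ (φ q) ⬝ᵥ (γ A *ᵥ ψ q))) (J ×ˢ U) := fun A =>
    (hf A).smul (h1 A)
  rw [funext (currentAlong_eq_sum f)]
  exact contMDiffOn_finsetSum fun A _ => h2 A

/-- The current `φ̄ γ̄^μ ψ` is divergence free: `∂_μ (√(-g) φ̄ γ̄^μ ψ) = 0` in every chart. -/
def DivergenceFree (σ : ℝ) (γ : Fin 4 → Matrix (Fin 4) (Fin 4) ℂ) (J : Set ℝ)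
    (e : Fin 4 → (q : ℝ × S) → TangentSpace I4 q) (φ ψ : ℝ × S → Spinor) : Prop :=
  ∀ c ∈ atlas E3 S, ∀ x ∈ coordDomain J c,
    ∑ μ, pd μ (fun z => (sqrtNegDet σ (frameInChart e c) z : ℂ) *
      currentAlong γ e φ ψ (coord c μ) (point c z)) x = 0

variable [IsManifold (𝓡 3) ∞ S]

/-- The current along `f` in terms of its components, `φ̄ γ̄(df) ψ = ∂_μ f φ̄ γ̄^μ ψ`. -/
lemma currentAlong_point (hc : c ∈ atlas E3 S) {f : ℝ × S → ℝ} {x : Fin 4 → ℝ}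
    (hx : x ∈ coordDomain univ c) (hf : MDifferentiableAt I4 𝓘(ℝ, ℝ) f (point c x)) :
    currentAlong γ e φ ψ f (point c x)
      = ∑ μ, ((pd μ (fun z => f (point c z)) x : ℝ) : ℂ) *
        currentAlong γ e φ ψ (coord c μ) (point c x) := by
  have h1 : ∀ A, frameDeriv e A f (point c x) = ∑ μ, frameDeriv e A (coord c μ) (point c x) *
      pd μ (fun z => f (point c z)) x := fun A => by
    have h2 := frameDeriv_eq_sum (e := e) hc A (point_mem hx).2 hf
    have h3 : (fun μ => coord c μ (point c x)) = x := coord_point hx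
    rwa [h3] at h2
  simp only [currentAlong_eq_sum, h1, Finset.sum_smul, Finset.mul_sum]
  rw [Finset.sum_comm]
  refine Finset.sum_congr rfl fun μ _ => Finset.sum_congr rfl fun A _ => ?_
  rw [mul_comm, mul_smul, Complex.real_smul]

lemma IsTetrad.continuous_density (he : IsTetrad J e)
    (hφ₁ : ContMDiffOn I4 𝓘(ℝ, Spinor) 1 φ (J ×ˢ univ))
    (hψ₁ : ContMDiffOn I4 𝓘(ℝ, Spinor) 1 ψ (J ×ˢ univ)) {t : ℝ} (ht : t ∈ J) :
    Continuous fun p => currentAlong γ e φ ψ Prod.fst (t, p) := by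
  have h1 := (contMDiffOn_currentAlong (γ := γ) hφ₁ hψ₁ le_rfl fun A =>
    he.contMDiffOn_frameDeriv A le_rfl isOpen_univ (f := Prod.fst) contMDiff_fst.contMDiffOn)
  exact continuousOn_univ.1 (h1.continuousOn.comp (Continuous.prodMk_right t).continuousOn
    fun p _ => ⟨ht, mem_univ _⟩)

lemma IsTetrad.continuous_flux (he : IsTetrad J e)
    (hφ₁ : ContMDiffOn I4 𝓘(ℝ, Spinor) 1 φ (J ×ˢ univ))
    (hψ₁ : ContMDiffOn I4 𝓘(ℝ, Spinor) 1 ψ (J ×ˢ univ)) {h : S → ℝ}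
    (hh : ContMDiff (𝓡 3) 𝓘(ℝ, ℝ) 1 h) {t : ℝ} (ht : t ∈ J) :
    Continuous fun p => currentAlong γ e φ ψ (fun q => h q.2) (t, p) := by
  have h1 := (contMDiffOn_currentAlong (γ := γ) hφ₁ hψ₁ (n := 0) (by simp) fun A =>
    he.contMDiffOn_frameDeriv A (by simp) isOpen_univ (f := fun q : ℝ × S => h q.2)
      ((zero_add (1 : ℕ∞ω)).symm ▸ (hh.comp contMDiff_snd).contMDiffOn))
  exact continuousOn_univ.1 (h1.continuousOn.comp (Continuous.prodMk_right t).continuousOn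
    fun p _ => ⟨ht, mem_univ _⟩)

theorem divergenceFree_of_solvesDirac (hγ : IsGammaRep ε σ γ) (hJ : IsOpen J) (he : IsTetrad J e)
    (hφ₁ : ContMDiffOn I4 𝓘(ℝ, Spinor) 1 φ (J ×ˢ univ))
    (hψ₁ : ContMDiffOn I4 𝓘(ℝ, Spinor) 1 ψ (J ×ˢ univ))
    (hψ : SolvesDirac ε σ γ m J e ψ)
    (hφ : SolvesDirac ε σ γ m J e φ ∨ SolvesAdjointDirac ε σ γ m J e φ) :
    DivergenceFree σ γ J e φ ψ := by
  intro c hc x hx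
  have hdiff : ∀ {f : ℝ × S → Spinor}, ContMDiffOn I4 𝓘(ℝ, Spinor) 1 f (J ×ˢ univ) →
      DifferentiableAt ℝ (fun z => f (point c z)) x := fun hf =>
    ((contDiffOn_comp_point (by simp) hc (hf.mono (prod_mono_right (subset_univ _)))).contDiffAt
      ((isOpen_coordDomain hJ).mem_nhds hx)).differentiableAt one_ne_zero
  have hE := he.diffEntries_frameInChart hJ hc hx
  have hdet := he.det_frameInChart_ne_zero hc hx
  refine sum_pd_current hγ hE hdet (hdiff hφ₁) (hdiff hψ₁) (hψ c hc x hx) ?_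
  exact hφ.elim (fun h => (h c hc x hx).adjoint hγ hE hdet (hdiff hφ₁)) fun h => h c hc x hx

end SpacetimeCurrent

/-! ### Balance laws for the slices -/

section Balance

variable {S : Type*} [TopologicalSpace S] [ChartedSpace E3 S] [MeasurableSpace S]
  {c : OpenPartialHomeomorph S E3} {J : Set ℝ} {σ : ℝ}
  {γ : Fin 4 → Matrix (Fin 4) (Fin 4) ℂ}
  {e : Fin 4 → (q : ℝ × S) → TangentSpace I4 q} {φ ψ : ℝ × S → Spinor}

/-- The balance law for the charge weighted with a function `h` on `S`: its rate of change is the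
flux of the current through the level sets of `h`,
`d/dt ∫ h φ̄ γ̄^0 ψ √(-g) d³x = ∫ φ̄ γ̄(dh) ψ √(-g) d³x`. -/
structure HasBalance (σ : ℝ) (γ : Fin 4 → Matrix (Fin 4) (Fin 4) ℂ) (J : Set ℝ)
    (e : Fin 4 → (q : ℝ × S) → TangentSpace I4 q) (φ ψ : ℝ × S → Spinor) (h : S → ℝ) :
    Prop where
  integrable_density : ∀ t ∈ J,
    Integrable (fun p => (h p : ℂ) * currentAlong γ e φ ψ Prod.fst (t, p)) (sliceMeasure σ e t)
  integrable_flux : ∀ t ∈ J,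
    Integrable (fun p => currentAlong γ e φ ψ (fun q => h q.2) (t, p)) (sliceMeasure σ e t)
  hasDerivAt : ∀ t ∈ J, HasDerivAt
    (fun s => ∫ p, (h p : ℂ) * currentAlong γ e φ ψ Prod.fst (s, p) ∂(sliceMeasure σ e s))
    (∫ p, currentAlong γ e φ ψ (fun q => h q.2) (t, p) ∂(sliceMeasure σ e t)) t
  continuousOn : ContinuousOn (fun t =>
    ∫ p, currentAlong γ e φ ψ (fun q => h q.2) (t, p) ∂(sliceMeasure σ e t)) J

variable [IsManifold (𝓡 3) ∞ S] [BorelSpace S]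

/-- The balance law for weights supported in the domain of a chart. -/
theorem DivergenceFree.hasBalance_of_tsupport_subset (hdiv : DivergenceFree σ γ J e φ ψ)
    (hJ : IsOpen J) (he : IsTetrad J e) (hσ : σ = 1 ∨ σ = -1)
    (hφ₁ : ContMDiffOn I4 𝓘(ℝ, Spinor) 1 φ (J ×ˢ univ))
    (hψ₁ : ContMDiffOn I4 𝓘(ℝ, Spinor) 1 ψ (J ×ˢ univ)) (hc : c ∈ atlas E3 S) {h : S → ℝ}
    (hh : ContMDiff (𝓡 3) 𝓘(ℝ, ℝ) 1 h) (hcs : HasCompactSupport h)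
    (hsub : tsupport h ⊆ c.source) : HasBalance σ γ J e φ ψ h := by
  have hT := c.open_target.measurableSet
  set K : Set E3 := c '' tsupport h
  have hK : IsCompact K := hcs.isCompact.image_of_continuousOn (c.continuousOn.mono hsub)
  have hKT : K ⊆ c.target := by
    rintro _ ⟨p, hp, rfl⟩
    exact c.map_source (hsub hp)
  have hU : IsOpen (coordDomain univ c) := isOpen_coordDomain isOpen_univ
  set V : Fin 4 → (Fin 4 → ℝ) → ℂ := fun μ z => (sqrtNegDet σ (frameInChart e c) z : ℂ) *
      currentAlong γ e φ ψ (coord c μ) (point c z)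
  set H : (Fin 4 → ℝ) → ℝ := fun z => h (point c z).2
  -- the weighted current density, extended by zero to all of `J × ℝ³`
  set W : Fin 4 → (Fin 4 → ℝ) → ℂ := fun μ =>
    (coordDomain univ c).indicator fun z => (H z : ℂ) * V μ z
  have hWV : ∀ μ, ∀ x ∈ coordDomain univ c, W μ =ᶠ[𝓝 x] fun z => (H z : ℂ) * V μ z := by
    intro μ x hx
    filter_upwards [hU.mem_nhds hx] with z hz
    exact indicator_of_mem hz _
  have hh0 : ∀ y ∈ c.target, y ∉ K → h (c.symm y) = 0 := by
    intro y hy hyK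
    refine image_eq_zero_of_notMem_tsupport fun hmem => hyK ⟨c.symm y, hmem, c.right_inv hy⟩
  have hW0 : ∀ μ, ∀ t ∈ J, ∀ y ∉ K, W μ (sliceMap (t, y)) = 0 := by
    intro μ t _ y hy
    refine indicator_apply_eq_zero.2 fun hx => ?_
    have h1 : H (sliceMap (t, y)) = 0 := hh0 y hx.2 hy
    rw [h1, Complex.ofReal_zero, zero_mul]
  have hVd : ∀ μ, ContDiffOn ℝ 1 (V μ) (coordDomain J c) := fun μ =>
    (Complex.ofRealCLM.contDiff.comp_contDiffOn (he.contDiffOn_sqrtNegDet hσ hc)).mul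
      (contDiffOn_comp_point (by simp) hc (contMDiffOn_currentAlong hφ₁ hψ₁ le_rfl fun A =>
        he.contMDiffOn_frameDeriv_coord hc A μ))
  have hHd : ContDiffOn ℝ 1 H (coordDomain J c) :=
    contDiffOn_comp_point (f := fun q => h q.2) (by simp) hc
      (hh.comp contMDiff_snd).contMDiffOn
  have hHd' : ContDiffOn ℝ 1 (fun z => (H z : ℂ)) (coordDomain J c) :=
    Complex.ofRealCLM.contDiff.comp_contDiffOn hHd
  have hWd : ∀ μ, ContDiffOn ℝ 1 (W μ) {x | x 0 ∈ J} := by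
    intro μ x hx
    refine ContDiffAt.contDiffWithinAt ?_
    by_cases hxT : WithLp.toLp 2 (Fin.tail x) ∈ c.target
    · have hm := (isOpen_coordDomain hJ).mem_nhds (⟨hx, hxT⟩ : x ∈ coordDomain J c)
      exact ((hHd'.contDiffAt hm).mul ((hVd μ).contDiffAt hm)).congr_of_eventuallyEq
        (hWV μ x ⟨mem_univ _, hxT⟩)
    · refine (contDiffAt_const (c := (0 : ℂ))).congr_of_eventuallyEq ?_
      have h2 : {x : Fin 4 → ℝ | x 0 ∈ J} ∩ {x | WithLp.toLp 2 (Fin.tail x) ∈ Kᶜ} ∈ 𝓝 x :=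
        ((isOpen_timeSlab hJ).inter (hK.isClosed.isOpen_compl.preimage
          continuous_toLp_tail)).mem_nhds ⟨hx, fun h => hxT (hKT h)⟩
      filter_upwards [h2] with z hz
      rw [← sliceMap_self z]
      exact hW0 μ _ hz.1 _ hz.2
  have hdens : ∀ t, (fun y => W 0 (sliceMap (t, y))) = c.target.indicator fun y =>
      (sliceDensity σ e c t y : ℂ) *
        ((h (c.symm y) : ℂ) * currentAlong γ e φ ψ Prod.fst (t, c.symm y)) := by
    intro t
    funext y
    by_cases hy : y ∈ c.target
    · rw [indicator_of_mem hy]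
      have h1 : sliceMap (t, y) ∈ coordDomain univ c := ⟨mem_univ _, hy⟩
      refine (indicator_of_mem h1 _).trans ?_
      exact mul_left_comm _ _ _
    · rw [indicator_of_notMem hy]
      exact indicator_of_notMem (fun h1 => hy h1.2) _
  have hflux : ∀ t ∈ J, (fun y => ∑ μ, pd μ (W μ) (sliceMap (t, y))) = c.target.indicator fun y =>
      (sliceDensity σ e c t y : ℂ) *
        currentAlong γ e φ ψ (fun q => h q.2) (t, c.symm y) := by
    intro t ht
    funext y
    by_cases hy : y ∈ c.target
    · rw [indicator_of_mem hy]
      have h1 : sliceMap (t, y) ∈ coordDomain univ c := ⟨mem_univ _, hy⟩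
      have hm := (isOpen_coordDomain hJ).mem_nhds (⟨ht, hy⟩ : sliceMap (t, y) ∈ coordDomain J c)
      have h2 : MDifferentiableAt I4 𝓘(ℝ, ℝ) (fun q : ℝ × S => h q.2) (point c (sliceMap (t, y))) :=
        (hh.comp contMDiff_snd).mdifferentiableAt one_ne_zero
      have h3 := currentAlong_point (γ := γ) (e := e) (φ := φ) (ψ := ψ) hc h1 h2
      change currentAlong γ e φ ψ (fun q => h q.2) (t, c.symm y) = _ at h3
      have h4 := hdiv c hc (sliceMap (t, y)) ⟨ht, hy⟩
      have h5 : ∀ μ, pd μ (W μ) (sliceMap (t, y))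
          = ((pd μ H (sliceMap (t, y)) : ℝ) : ℂ) * V μ (sliceMap (t, y))
            + (H (sliceMap (t, y)) : ℂ) * pd μ (V μ) (sliceMap (t, y)) := by
        intro μ
        rw [pd_congr (hWV μ _ h1), pd_mul ((hHd'.contDiffAt hm).differentiableAt one_ne_zero)
          (((hVd μ).contDiffAt hm).differentiableAt one_ne_zero),
          pd_ofReal ((hHd.contDiffAt hm).differentiableAt one_ne_zero)]
      simp only [h5, Finset.sum_add_distrib]
      rw [← Finset.mul_sum, h4, mul_zero, add_zero, h3, Finset.mul_sum]
      exact Finset.sum_congr rfl fun μ _ => mul_left_comm _ _ _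
    · rw [indicator_of_notMem hy]
      exact Finset.sum_eq_zero fun μ _ =>
        pd_eq_zero_of_notMem hJ hK (hW0 μ) μ ht fun h => hy (hKT h)
  have hsuppD : ∀ t, ∀ p ∉ c.source,
      (h p : ℂ) * currentAlong γ e φ ψ Prod.fst (t, p) = 0 := by
    intro t p hp
    rw [image_eq_zero_of_notMem_tsupport fun h => hp (hsub h), Complex.ofReal_zero, zero_mul]
  have hsuppF : ∀ t, ∀ p ∉ c.source,
      currentAlong γ e φ ψ (fun q => h q.2) (t, p) = 0 := fun t p hp =>
    currentAlong_eq_zero_of_notMem_tsupport fun h => hp (hsub h)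
  have hD := fun t (ht : t ∈ J) => he.integral_sliceMeasure hσ hc ht
    ((Complex.continuous_ofReal.comp hh.continuous).mul
      (he.continuous_density (γ := γ) hφ₁ hψ₁ ht)) (hsuppD t)
  have hF := fun t (ht : t ∈ J) => he.integral_sliceMeasure hσ hc ht
    (he.continuous_flux (γ := γ) hφ₁ hψ₁ hh ht) (hsuppF t)
  have hslab := isOpen_timeSlab hJ
  have hFW : ∀ t ∈ J, ∫ p, currentAlong γ e φ ψ (fun q => h q.2) (t, p) ∂(sliceMeasure σ e t)
      = ∫ y, ∑ μ, pd μ (W μ) (sliceMap (t, y)) := fun t ht => by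
    rw [(hF t ht).2, ← integral_indicator hT, hflux t ht]
  have hDW : ∀ t ∈ J, ∫ p, (h p : ℂ) * currentAlong γ e φ ψ Prod.fst (t, p) ∂(sliceMeasure σ e t)
      = ∫ y, W 0 (sliceMap (t, y)) := fun t ht => by
    rw [hdens, integral_indicator hT]
    exact (hD t ht).2
  have hpdc : ContinuousOn (fun x => ∑ μ, pd μ (W μ) x) {x | x 0 ∈ J} :=
    continuousOn_finsetSum _ fun μ _ => continuousOn_pd hslab (hWd μ) μ
  have hpds : ∀ t ∈ J, ∀ y ∉ K, ∑ μ, pd μ (W μ) (sliceMap (t, y)) = 0 := fun t ht y hy =>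
    Finset.sum_eq_zero fun μ _ => pd_eq_zero_of_notMem hJ hK (hW0 μ) μ ht hy
  refine ⟨fun t ht => ?_, fun t ht => ?_, fun t ht => ?_, ?_⟩
  · refine (hD t ht).1.2 ?_
    rw [← integrable_indicator_iff hT]
    have := integrable_slice hK (hWd 0).continuousOn (hW0 0) ht
    rwa [hdens] at this
  · refine (hF t ht).1.2 ?_
    rw [← integrable_indicator_iff hT, ← hflux t ht]
    exact integrable_slice hK hpdc hpds ht
  · rw [hFW t ht]
    refine (hasDerivAt_integral_divergence hJ hK hWd hW0 ht).congr_of_eventuallyEq ?_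
    filter_upwards [hJ.mem_nhds ht] with s hs
    exact hDW s hs
  · exact (continuousOn_integral_slice hK hpdc hpds).congr hFW

end Balance

/-! ### Localization by a partition of unity -/

section Localization

variable {S : Type*} [TopologicalSpace S] [ChartedSpace E3 S]
  {J : Set ℝ} {σ : ℝ} {γ : Fin 4 → Matrix (Fin 4) (Fin 4) ℂ}
  {e : Fin 4 → (q : ℝ × S) → TangentSpace I4 q} {φ ψ : ℝ × S → Spinor}

lemma frameDeriv_add {f g : ℝ × S → ℝ} {q : ℝ × S} (hf : MDifferentiableAt I4 𝓘(ℝ, ℝ) f q)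
    (hg : MDifferentiableAt I4 𝓘(ℝ, ℝ) g q) (A : Fin 4) :
    frameDeriv e A (fun q => f q + g q) q = frameDeriv e A f q + frameDeriv e A g q := by
  have h1 := hf.hasMFDerivAt.add hg.hasMFDerivAt
  rw [frameDeriv, show (fun q => f q + g q) = f + g from rfl, h1.mfderiv]
  rfl

lemma currentAlong_add {f g : ℝ × S → ℝ} {q : ℝ × S} (hf : MDifferentiableAt I4 𝓘(ℝ, ℝ) f q)
    (hg : MDifferentiableAt I4 𝓘(ℝ, ℝ) g q) :
    currentAlong γ e φ ψ (fun q => f q + g q) q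
      = currentAlong γ e φ ψ f q + currentAlong γ e φ ψ g q := by
  simp only [currentAlong_eq_sum, frameDeriv_add hf hg, add_smul, Finset.sum_add_distrib]

lemma currentAlong_const (a : ℝ) (q : ℝ × S) : currentAlong γ e φ ψ (fun _ => a) q = 0 := by
  simp only [currentAlong_eq_sum, frameDeriv_const, zero_smul, Finset.sum_const_zero]

lemma frameDeriv_comp {f : ℝ × S → ℝ} {g : ℝ → ℝ} {g' : ℝ} {q : ℝ × S}
    (hf : MDifferentiableAt I4 𝓘(ℝ, ℝ) f q) (hg : HasDerivAt g g' (f q)) (A : Fin 4) :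
    frameDeriv e A (fun q => g (f q)) q = g' * frameDeriv e A f q := by
  have h1 := HasMFDerivAt.comp q hg.hasFDerivAt.hasMFDerivAt hf.hasMFDerivAt
  rw [frameDeriv, show (fun q => g (f q)) = g ∘ f from rfl, h1.mfderiv]
  exact mul_comm _ _

lemma currentAlong_comp {f : ℝ × S → ℝ} {g : ℝ → ℝ} {g' : ℝ} {q : ℝ × S}
    (hf : MDifferentiableAt I4 𝓘(ℝ, ℝ) f q) (hg : HasDerivAt g g' (f q)) :
    currentAlong γ e φ ψ (fun q => g (f q)) q = g' • currentAlong γ e φ ψ f q := by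
  simp only [currentAlong_eq_sum, frameDeriv_comp hf hg, mul_smul, Finset.smul_sum]

variable [MeasurableSpace S]

lemma HasBalance.zero : HasBalance σ γ J e φ ψ fun _ => 0 := by
  constructor <;> simp [currentAlong_const, hasDerivAt_const, continuousOn_const]

lemma HasBalance.add {h k : S → ℝ} (hh : ContMDiff (𝓡 3) 𝓘(ℝ, ℝ) 1 h)
    (hk : ContMDiff (𝓡 3) 𝓘(ℝ, ℝ) 1 k) (hb : HasBalance σ γ J e φ ψ h)
    (kb : HasBalance σ γ J e φ ψ k) (hJ : IsOpen J) :
    HasBalance σ γ J e φ ψ fun p => h p + k p := by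
  have h1 : ∀ t, (fun p => ((h p + k p : ℝ) : ℂ) * currentAlong γ e φ ψ Prod.fst (t, p))
      = fun p => (h p : ℂ) * currentAlong γ e φ ψ Prod.fst (t, p)
        + (k p : ℂ) * currentAlong γ e φ ψ Prod.fst (t, p) := fun t => by
    funext p
    rw [Complex.ofReal_add, add_mul]
  have h2 : ∀ t, (fun p => currentAlong γ e φ ψ (fun q => h q.2 + k q.2) (t, p))
      = fun p => currentAlong γ e φ ψ (fun q => h q.2) (t, p)
        + currentAlong γ e φ ψ (fun q => k q.2) (t, p) := fun t => by
    funext p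
    exact currentAlong_add ((hh.comp contMDiff_snd).mdifferentiableAt one_ne_zero)
      ((hk.comp contMDiff_snd).mdifferentiableAt one_ne_zero)
  have h3 : ∀ t ∈ J, ∫ p, currentAlong γ e φ ψ (fun q => h q.2 + k q.2) (t, p)
      ∂(sliceMeasure σ e t)
      = ∫ p, currentAlong γ e φ ψ (fun q => h q.2) (t, p) ∂(sliceMeasure σ e t)
        + ∫ p, currentAlong γ e φ ψ (fun q => k q.2) (t, p) ∂(sliceMeasure σ e t) :=
    fun t ht => by
      rw [h2, integral_add (hb.integrable_flux t ht) (kb.integrable_flux t ht)]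
  refine ⟨fun t ht => ?_, fun t ht => ?_, fun t ht => ?_, ?_⟩
  · rw [h1]
    exact (hb.integrable_density t ht).add (kb.integrable_density t ht)
  · rw [h2]
    exact (hb.integrable_flux t ht).add (kb.integrable_flux t ht)
  · rw [h3 t ht]
    refine ((hb.hasDerivAt t ht).add (kb.hasDerivAt t ht)).congr_of_eventuallyEq ?_
    filter_upwards [hJ.mem_nhds ht] with s hs
    rw [h1, integral_add (hb.integrable_density s hs) (kb.integrable_density s hs)]
    rfl
  · exact (hb.continuousOn.add kb.continuousOn).congr h3

lemma HasBalance.sum {ι : Type*} {s : Finset ι} {h : ι → S → ℝ} (hJ : IsOpen J)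
    (hh : ∀ i ∈ s, ContMDiff (𝓡 3) 𝓘(ℝ, ℝ) 1 (h i))
    (hb : ∀ i ∈ s, HasBalance σ γ J e φ ψ (h i)) :
    HasBalance σ γ J e φ ψ (fun p => ∑ i ∈ s, h i p) := by
  classical
  induction s using Finset.induction_on with
  | empty => simpa using HasBalance.zero
  | insert i s hi ih =>
    simp only [Finset.sum_insert hi]
    have hs : ∀ j ∈ s, j ∈ insert i s := fun j hj => Finset.mem_insert_of_mem hj
    exact (hb i (Finset.mem_insert_self i s)).add (hh i (Finset.mem_insert_self i s))
      (contMDiff_finsetSum fun j hj => hh j (hs j hj))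
      (ih (fun j hj => hh j (hs j hj)) fun j hj => hb j (hs j hj)) hJ

variable [T2Space S] [SecondCountableTopology S] [IsManifold (𝓡 3) ∞ S] [BorelSpace S]

/-- The balance law for weights of compact support. -/
theorem DivergenceFree.hasBalance (hdiv : DivergenceFree σ γ J e φ ψ)
    (hJ : IsOpen J) (he : IsTetrad J e) (hσ : σ = 1 ∨ σ = -1)
    (hφ₁ : ContMDiffOn I4 𝓘(ℝ, Spinor) 1 φ (J ×ˢ univ))
    (hψ₁ : ContMDiffOn I4 𝓘(ℝ, Spinor) 1 ψ (J ×ˢ univ)) {h : S → ℝ}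
    (hh : ContMDiff (𝓡 3) 𝓘(ℝ, ℝ) 1 h) (hcs : HasCompactSupport h) :
    HasBalance σ γ J e φ ψ h := by
  have : LocallyCompactSpace S := ChartedSpace.locallyCompactSpace E3 S
  obtain ⟨F, hF⟩ := hcs.isCompact.elim_finite_subcover (fun p : S => (chartAt E3 p).source)
    (fun p => (chartAt E3 p).open_source) fun p _ => mem_iUnion.2 ⟨p, mem_chart_source E3 p⟩
  obtain ⟨f, hf⟩ := SmoothPartitionOfUnity.exists_isSubordinate (𝓡 3) (isClosed_tsupport h)
    (fun i : F => (chartAt E3 (i : S)).source) (fun i => (chartAt E3 (i : S)).open_source)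
    (fun p hp => by simpa using hF hp)
  have hsum : h = fun p => ∑ i, f i p * h p := by
    funext p
    rw [← Finset.sum_mul]
    by_cases hp : p ∈ tsupport h
    · have h1 := f.sum_eq_one hp
      rw [finsum_eq_sum_of_fintype] at h1
      rw [h1, one_mul]
    · rw [image_eq_zero_of_notMem_tsupport hp, mul_zero]
  have hsm : ∀ i, ContMDiff (𝓡 3) 𝓘(ℝ, ℝ) 1 fun p => f i p * h p := fun i =>
    ((f i).contMDiff.of_le (by simp)).mul hh
  rw [hsum]
  refine HasBalance.sum hJ (fun i _ => hsm i) fun i _ => ?_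
  exact hdiv.hasBalance_of_tsupport_subset hJ he hσ hφ₁ hψ₁ (chart_mem_atlas E3 (i : S)) (hsm i)
    hcs.mul_left ((tsupport_mul_subset_left).trans (hf i))

end Localization

/-! ### Conservation of the total charge -/

section Conservation

variable {S : Type*} [TopologicalSpace S] [ChartedSpace E3 S] [MeasurableSpace S]
  {J : Set ℝ} {σ : ℝ} {γ : Fin 4 → Matrix (Fin 4) (Fin 4) ℂ}
  {e : Fin 4 → (q : ℝ × S) → TangentSpace I4 q} {φ ψ : ℝ × S → Spinor}

/-- The charge in a region changes by the time integral of the flux. -/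
lemma HasBalance.integral_flux {h : S → ℝ} (hb : HasBalance σ γ J e φ ψ h) {a b : ℝ}
    (hab : a ≤ b) (hI : Icc a b ⊆ J) :
    ∫ t in a..b, ∫ p, currentAlong γ e φ ψ (fun q => h q.2) (t, p) ∂(sliceMeasure σ e t)
      = ∫ p, (h p : ℂ) * currentAlong γ e φ ψ Prod.fst (b, p) ∂(sliceMeasure σ e b)
        - ∫ p, (h p : ℂ) * currentAlong γ e φ ψ Prod.fst (a, p) ∂(sliceMeasure σ e a) := by
  have hI' : uIcc a b ⊆ J := by rwa [uIcc_of_le hab]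
  exact intervalIntegral.integral_eq_sub_of_hasDerivAt (fun t ht => hb.hasDerivAt t (hI' ht))
    (hb.continuousOn.mono hI').intervalIntegrable

/-- The derivative of the smooth step function is bounded and vanishes off `[0, 1]`. -/
lemma exists_bound_deriv_smoothTransition : ∃ C : ℝ, 0 ≤ C ∧
    ∀ u, |deriv Real.smoothTransition u| ≤ (Icc (0 : ℝ) 1).indicator (fun _ => C) u := by
  have hcont : Continuous (deriv Real.smoothTransition) :=
    (Real.smoothTransition.contDiff (n := 1)).continuous_deriv le_rfl
  obtain ⟨C, hC⟩ := isCompact_Icc.exists_bound_of_continuousOn (s := Icc (0 : ℝ) 1)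
    hcont.continuousOn
  refine ⟨C, (norm_nonneg _).trans (hC 0 (by simp)), fun u => ?_⟩
  by_cases hu : u ∈ Icc (0 : ℝ) 1
  · rw [indicator_of_mem hu]
    exact hC u hu
  · rw [indicator_of_notMem hu]
    have h1 : ∃ a : ℝ, Real.smoothTransition =ᶠ[𝓝 u] fun _ => a := by
      rcases lt_or_ge u 0 with h0 | h0
      · refine ⟨0, ?_⟩
        filter_upwards [Iio_mem_nhds h0] with v hv
        exact Real.smoothTransition.zero_of_nonpos (le_of_lt hv)
      · have h2 : 1 < u := lt_of_not_ge fun h => hu ⟨h0, h⟩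
        refine ⟨1, ?_⟩
        filter_upwards [Ioi_mem_nhds h2] with v hv
        exact Real.smoothTransition.one_of_one_le (le_of_lt hv)
    obtain ⟨a, ha⟩ := h1
    rw [ha.deriv_eq, deriv_const, abs_zero]

variable [T2Space S] [SecondCountableTopology S] [IsManifold (𝓡 3) ∞ S] [BorelSpace S]

/-- The total charge is the same on all slices if the current vanishes rapidly at infinity. -/
theorem DivergenceFree.integral_eq_of_vanishRapidly (hdiv : DivergenceFree σ γ J e φ ψ)
    (hJ : IsOpen J) (he : IsTetrad J e) (hσ : σ = 1 ∨ σ = -1)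
    (hφ₁ : ContMDiffOn I4 𝓘(ℝ, Spinor) 1 φ (J ×ˢ univ))
    (hψ₁ : ContMDiffOn I4 𝓘(ℝ, Spinor) 1 ψ (J ×ˢ univ)) (hinf : VanishRapidly σ γ J e φ ψ)
    {a b : ℝ} (hab : a ≤ b) (hI : Icc a b ⊆ J) :
    ∫ p, currentAlong γ e φ ψ Prod.fst (b, p) ∂(sliceMeasure σ e b)
      = ∫ p, currentAlong γ e φ ψ Prod.fst (a, p) ∂(sliceMeasure σ e a) := by
  obtain ⟨ρ, hρ, hcpt, hlim⟩ := hinf.decay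
  obtain ⟨C, hC0, hC⟩ := exists_bound_deriv_smoothTransition
  -- the cutoff is `1` where `ρ ≤ R` and `0` where `2 R ≤ ρ`
  set η : ℝ → S → ℝ := fun R p => Real.smoothTransition (2 - ρ p / R)
  have hηsm : ∀ R, ContMDiff (𝓡 3) 𝓘(ℝ, ℝ) 1 (η R) := fun R =>
    ContMDiff.comp (g := fun u : ℝ => Real.smoothTransition (2 - u / R))
      (Real.smoothTransition.contDiff.comp
        (contDiff_const.sub (contDiff_id.div_const R))).contMDiff hρ
  have hηcs : ∀ R, 0 < R → HasCompactSupport (η R) := fun R hR => by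
    refine HasCompactSupport.intro (hcpt (2 * R)) fun p hp => ?_
    refine Real.smoothTransition.zero_of_nonpos ?_
    have h1 : 2 * R < ρ p := lt_of_not_ge hp
    have h2 : 2 < ρ p / R := (lt_div_iff₀ hR).2 h1
    linarith
  have hbal : ∀ R, 0 < R → HasBalance σ γ J e φ ψ (η R) := fun R hR =>
    hdiv.hasBalance hJ he hσ hφ₁ hψ₁ (hηsm R) (hηcs R hR)
  have hshell : ∀ R, MeasurableSet {p | R ≤ ρ p ∧ ρ p ≤ 2 * R} := fun R =>
    ((isClosed_le continuous_const hρ.continuous).inter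
      (isClosed_le hρ.continuous continuous_const)).measurableSet
  have hflux : ∀ R, 0 < R → ∀ t, ∀ p : S,
      ‖currentAlong γ e φ ψ (fun q => η R q.2) (t, p)‖ₑ
        ≤ {p | R ≤ ρ p ∧ ρ p ≤ 2 * R}.indicator (fun p => ENNReal.ofReal (C * R⁻¹) *
          ‖currentAlong γ e φ ψ (fun q => ρ q.2) (t, p)‖ₑ) p := by
    intro R hR t p
    have h1 : HasDerivAt (fun u : ℝ => Real.smoothTransition (2 - u / R))
        (deriv Real.smoothTransition (2 - ρ p / R) * -(1 / R)) (ρ p) := by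
      have h2 : HasDerivAt (fun u : ℝ => 2 - u / R) (-(1 / R)) (ρ p) :=
        ((hasDerivAt_id (ρ p)).div_const R).const_sub 2
      exact HasDerivAt.comp (ρ p) ((Real.smoothTransition.contDiff (n := 1)).differentiable
        one_ne_zero _).hasDerivAt h2
    have h3 := currentAlong_comp (γ := γ) (e := e) (φ := φ) (ψ := ψ) (q := (t, p))
      (f := fun q => ρ q.2) ((hρ.comp contMDiff_snd).mdifferentiableAt one_ne_zero) h1
    have h4 : currentAlong γ e φ ψ (fun q => η R q.2) (t, p) = _ := h3
    have h5 : |deriv Real.smoothTransition (2 - ρ p / R) * -(1 / R)|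
        = |deriv Real.smoothTransition (2 - ρ p / R)| * R⁻¹ := by
      rw [abs_mul, abs_neg, abs_of_pos (one_div_pos.2 hR), one_div]
    rw [h4, enorm_smul, ← ofReal_norm, Real.norm_eq_abs, h5]
    by_cases hp : R ≤ ρ p ∧ ρ p ≤ 2 * R
    · rw [indicator_of_mem (by exact hp)]
      gcongr
      refine (hC _).trans ?_
      exact indicator_le_self' (fun _ _ => hC0) _
    · rw [indicator_of_notMem (by exact hp)]
      have h6 : 2 - ρ p / R ∉ Icc (0 : ℝ) 1 := fun h => hp
        ⟨(one_le_div hR).1 (by linarith [h.2]), (div_le_iff₀ hR).1 (by linarith [h.1])⟩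
      have h7 := hC (2 - ρ p / R)
      rw [indicator_of_notMem h6] at h7
      rw [le_antisymm h7 (abs_nonneg _)]
      simp
  set Fl : ℝ → ENNReal := fun R => ∫⁻ t in Icc a b, ∫⁻ p in {p | R ≤ ρ p ∧ ρ p ≤ 2 * R},
            ‖currentAlong γ e φ ψ (fun q => ρ q.2) (t, p)‖ₑ ∂(sliceMeasure σ e t)
  have hbound : ∀ R, 0 < R →
      ‖∫ p, (η R p : ℂ) * currentAlong γ e φ ψ Prod.fst (b, p) ∂(sliceMeasure σ e b)
        - ∫ p, (η R p : ℂ) * currentAlong γ e φ ψ Prod.fst (a, p) ∂(sliceMeasure σ e a)‖ₑ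
      ≤ ENNReal.ofReal C * (ENNReal.ofReal R⁻¹ * Fl R) := by
    intro R hR
    rw [← (hbal R hR).integral_flux hab hI, intervalIntegral.integral_of_le hab]
    calc _ ≤ ∫⁻ t in Ioc a b, ‖∫ p, currentAlong γ e φ ψ (fun q => η R q.2) (t, p)
            ∂(sliceMeasure σ e t)‖ₑ := enorm_integral_le_lintegral_enorm _
      _ ≤ ∫⁻ t in Icc a b, ENNReal.ofReal (C * R⁻¹) * ∫⁻ p in {p | R ≤ ρ p ∧ ρ p ≤ 2 * R},
            ‖currentAlong γ e φ ψ (fun q => ρ q.2) (t, p)‖ₑ ∂(sliceMeasure σ e t) := by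
        refine (lintegral_mono_set Ioc_subset_Icc_self).trans (lintegral_mono fun t => ?_)
        refine (enorm_integral_le_lintegral_enorm _).trans ?_
        refine (lintegral_mono (hflux R hR t)).trans ?_
        rw [lintegral_indicator (hshell R), lintegral_const_mul' _ _ ENNReal.ofReal_ne_top]
      _ = _ := by
        rw [lintegral_const_mul' _ _ ENNReal.ofReal_ne_top, ENNReal.ofReal_mul hC0, mul_assoc]
  have hconv : ∀ t ∈ J, Tendsto
      (fun R => ∫ p, (η R p : ℂ) * currentAlong γ e φ ψ Prod.fst (t, p) ∂(sliceMeasure σ e t))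
      atTop (𝓝 (∫ p, currentAlong γ e φ ψ Prod.fst (t, p) ∂(sliceMeasure σ e t))) := by
    intro t ht
    refine tendsto_integral_filter_of_dominated_convergence
      (fun p => ‖currentAlong γ e φ ψ Prod.fst (t, p)‖) ?_ ?_ (hinf.integrable t ht).norm ?_
    · exact Eventually.of_forall fun R =>
        ((Complex.continuous_ofReal.comp (hηsm R).continuous).mul
          (he.continuous_density (γ := γ) hφ₁ hψ₁ ht)).aestronglyMeasurable
    · refine Eventually.of_forall fun R => Eventually.of_forall fun p => ?_
      rw [norm_mul, Complex.norm_real, Real.norm_eq_abs,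
        abs_of_nonneg (Real.smoothTransition.nonneg _)]
      exact mul_le_of_le_one_left (norm_nonneg _) (Real.smoothTransition.le_one _)
    · refine Eventually.of_forall fun p => tendsto_const_nhds.congr' ?_
      filter_upwards [eventually_ge_atTop (ρ p), eventually_gt_atTop 0] with R hR hR0
      have h1 : η R p = 1 := by
        refine Real.smoothTransition.one_of_one_le ?_
        have := (div_le_one hR0).2 hR
        linarith
      rw [h1, Complex.ofReal_one, one_mul]
  have hL := (((hconv b (hI (right_mem_Icc.2 hab))).sub
    (hconv a (hI (left_mem_Icc.2 hab)))).enorm)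
  have hR : Tendsto (fun R => ENNReal.ofReal C * (ENNReal.ofReal R⁻¹ * Fl R)) atTop (𝓝 0) := by
    simpa using ENNReal.Tendsto.const_mul (hlim a b hI) (Or.inr ENNReal.ofReal_ne_top)
  have h0 := le_of_tendsto_of_tendsto hL hR <| by
    filter_upwards [eventually_gt_atTop 0] with R hR using hbound R hR
  rwa [nonpos_iff_eq_zero, enorm_eq_zero, sub_eq_zero] at h0

end Conservation

end CurvedDirac

open CurvedDirac in
/-- Conservation of the scalar product of two solutions of the Dirac equation. The slices of
constant `t = x^0` either are closed (compact, without boundary), or the fields vanish rapidly at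
spatial infinity. -/
theorem proposition4 {S : Type*} [TopologicalSpace S] [T2Space S] [SecondCountableTopology S]
    [ChartedSpace E3 S] [IsManifold (𝓡 3) ∞ S] [MeasurableSpace S] [BorelSpace S]
    (ε σ : ℝ) (γ : Fin 4 → Matrix (Fin 4) (Fin 4) ℂ) (hγ : IsGammaRep ε σ γ)
    (m : ℝ) (J : Set ℝ) (hJ : IsOpen J) (hJ' : J.OrdConnected)
    (e : Fin 4 → (q : ℝ × S) → TangentSpace I4 q) (he : IsTetrad J e)
    (φ ψ : ℝ × S → Spinor)
    (hφ₁ : ContMDiffOn I4 𝓘(ℝ, Spinor) 1 φ (J ×ˢ univ))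
    (hψ₁ : ContMDiffOn I4 𝓘(ℝ, Spinor) 1 ψ (J ×ˢ univ))
    (hψ : SolvesDirac ε σ γ m J e ψ)
    (hφ : SolvesDirac ε σ γ m J e φ ∨ SolvesAdjointDirac ε σ γ m J e φ)
    (hinf : CompactSpace S ∨ VanishRapidly σ γ J e φ ψ) :
    (∀ t ∈ J, Integrable (fun p => currentAlong γ e φ ψ Prod.fst (t, p)) (sliceMeasure σ e t)) ∧
    (∀ t ∈ J, HasDerivAt (fun s => scalarProduct σ γ e φ ψ s) 0 t) ∧
    (∀ s ∈ J, ∀ t ∈ J, scalarProduct σ γ e φ ψ s = scalarProduct σ γ e φ ψ t) := by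
  have hσ := hγ.signature_eq
  have hdiv : DivergenceFree σ γ J e φ ψ :=
    divergenceFree_of_solvesDirac hγ hJ he hφ₁ hψ₁ hψ hφ
  obtain ⟨hint, hmono⟩ : (∀ t ∈ J, Integrable (fun p => currentAlong γ e φ ψ Prod.fst (t, p))
      (sliceMeasure σ e t)) ∧ ∀ a b : ℝ, a ≤ b → Icc a b ⊆ J →
      ∫ p, currentAlong γ e φ ψ Prod.fst (b, p) ∂(sliceMeasure σ e b)
        = ∫ p, currentAlong γ e φ ψ Prod.fst (a, p) ∂(sliceMeasure σ e a) := by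
    rcases hinf with hS | hinf
    · have hb : HasBalance σ γ J e φ ψ fun _ => 1 :=
        hdiv.hasBalance hJ he hσ hφ₁ hψ₁ contMDiff_const (HasCompactSupport.of_compactSpace _)
      refine ⟨fun t ht => by simpa using hb.integrable_density t ht, fun a b hab hI => ?_⟩
      have h1 := hb.integral_flux hab hI
      simp only [currentAlong_const, integral_zero, intervalIntegral.integral_zero,
        Complex.ofReal_one, one_mul] at h1
      exact sub_eq_zero.1 h1.symm
    · exact ⟨hinf.integrable, fun a b hab hI =>
        hdiv.integral_eq_of_vanishRapidly hJ he hσ hφ₁ hψ₁ hinf hab hI⟩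
  have hconst : ∀ s ∈ J, ∀ t ∈ J,
      scalarProduct σ γ e φ ψ s = scalarProduct σ γ e φ ψ t := by
    intro s hs t ht
    rw [scalarProduct, scalarProduct, neg_inj]
    rcases le_total s t with h | h
    · exact (hmono s t h (hJ'.out hs ht)).symm
    · exact hmono t s h (hJ'.out ht hs)
  refine ⟨hint, fun t ht => ?_, hconst⟩
  refine (hasDerivAt_const t (scalarProduct σ γ e φ ψ t)).congr_of_eventuallyEq ?_
  filter_upwards [hJ.mem_nhds ht] with s hs using hconst s hs t ht
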